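/- \textbf{Theorem (Conway's Normal Form Theorem).} Surreal numbers are Conway's pairs $x=\{L_x\mid R_x\}$ of sets of surreal numbers such that no member of $R_x$ is $\le$ a member of $L_x$. Here $x\le y$ iff $y\le l$ for no $l\in L_x$ and $r\le x$ for no $r\in R_y$. We write $x\approx y$ for $x\le y\wedge y\le x$ (distinct pairs may be equivalent), $x<y$ for $x\le y\wedge y\not\le x$, and $|x|$ for $x$ if $0\le x$ and $-x$ otherwise. Arithmetic is given by Conway's recursive formulas. The birthday $\mathfrak b(x)$ is the least ordinal greater than the birthdays of all members of $L_x\cup R_x$. \emph{Canonical representatives.} In every $\approx$-class of surreal numbers one representative, called canonical (a \emph{uSurreal}), is fixed by recursion on the least birthday $\alpha$ of members of the class: it is a member of birthday $\alpha$ all of whose left and right options are canonical representatives of classes of least birthday $<\alpha$, chosen (by global choice) among those for which the Hessenberg sum of the cardinalities of the left and the right option set is least. Thus two canonical representatives that are equivalent are equal, and the canonical representative of the class of $0=\{\,\mid\,\}$ is $0$. \emph{Reals and powers of $\omega$.} Put $s_{\mathbb Z}(0)=0$, $s_{\mathbb Z}(i)=\{s_{\mathbb Z}(i-1)\mid\,\}$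 for $i>0$, and $s_{\mathbb Z}(i)=\{\,\mid s_{\mathbb Z}(i+1)\}$ for $i<0$. For dyadic $d$ put $s_{\mathbb D}(d)=s_{\mathbb Z}(d)$ if $d\in\mathbb Z$, and $s_{\mathbb D}\bigl(\tfrac{2j+1}{2^{p+1}}\bigr)=\{s_{\mathbb D}(\tfrac{j}{2^p})\mid s_{\mathbb D}(\tfrac{j+1}{2^p})\}$ for $j\in\mathbb Z$, $p\in\mathbb N$. For $r\in\mathbb R$ let $s_{\mathbb R}(r)$ be the canonical representative of $\bigl\{s_{\mathbb D}\bigl(\tfrac{\lceil r2^n-1\rceil}{2^n}\bigr)\bigm| s_{\mathbb D}\bigl(\tfrac{\lfloor r2^n+1\rfloor}{2^n}\bigr)\bigr\}_{n\in\mathbb N}$. Define recursively $\omega^x=\{0,\ s_{\mathbb R}(r)\cdot\omega^{x^L}\mid s_{\mathbb R}(s)\cdot\omega^{x^R}\}$, where $r,s$ range over the positive reals and $x^L,x^R$ over the members of $L_x,R_x$. Write $x<^\infty y$ if $x\cdot s_{\mathbb Z}(n)<y$ for all integers $n\ge 1$. \emph{Transfinite sums.} Let $\theta$ be an ordinal,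 $(r_\beta)_{\beta<\theta}$ a sequence of non-zero reals and $(y_\beta)_{\beta<\theta}$ a strictly decreasing sequence of canonical representatives. The sum $\sum_{\beta<\theta}\omega^{y_\beta}\cdot s_{\mathbb R}(r_\beta)$ is the last entry $s_\theta$ of a sequence $(s_\beta)_{\beta\le\theta}$ of canonical representatives such that $s_0=0$ and, for every $0<\beta\le\theta$, with $I_\beta$ the class of surreal numbers $a$ satisfying $$\bigl|a-\bigl(s_\gamma+s_{\mathbb R}(r_\gamma)\cdot\omega^{y_\gamma}\bigr)\bigr|<^\infty\omega^{y_\gamma}\quad\text{for all }\gamma<\beta,$$ $s_\beta$ is the simplest element of $I_\beta$: $s_\beta\in I_\beta$, and $\mathfrak b(s_\beta)<\mathfrak b(a)$ for every canonical representative $a\ne s_\beta$ in $I_\beta$. \emph{Claim.} For every surreal number $x$ there are an ordinal $\theta$, a sequence $(r_\beta)_{\beta<\theta}$ of non-zero reals and a strictly decreasing sequence $(y_\beta)_{\beta<\theta}$ of canonical representatives such that the sum $\sum_{\beta<\theta}\omega^{y_\beta}\cdot s_{\mathbb R}(r_\beta)$ exists, is unique, and satisfies $$x\approx\sum_{\beta<\theta}\omega^{y_\beta}\cdot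 s_{\mathbb R}(r_\beta),\qquad \mathfrak b\Bigl(\sum_{\beta<\theta}\omega^{y_\beta}\cdot s_{\mathbb R}(r_\beta)\Bigr)\le\mathfrak b(x).$$ Moreover $\theta$, $(r_\beta)_{\beta<\theta}$ and $(y_\beta)_{\beta<\theta}$ are uniquely determined by $x$: any ordinal and sequences of these kinds having a sum equivalent to $x$ coincide with them. -/

import Mathlib

universe u

/-- Formal expressions `{L | R}`: a family `L` of left options and a family `R` of right options,
both already constructed. -/
inductive PGame : Type (u + 1)
  | mk (α β : Type u) (L : α → PGame) (R : β → PGame) : PGame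

namespace PGame

noncomputable section

/-- The index type of the left options. -/
def LeftMoves : PGame.{u} → Type u
  | mk α _ _ _ => α

/-- The index type of the right options. -/
def RightMoves : PGame.{u} → Type u
  | mk _ β _ _ => β

/-- The left options `x^L`. -/
def moveLeft : (x : PGame.{u}) → x.LeftMoves → PGame.{u}
  | mk _ _ L _ => L

/-- The right options `x^R`. -/
def moveRight : (x : PGame.{u}) → x.RightMoves → PGame.{u}
  | mk _ _ _ R => R

/-- `L_x`, the set of left options. -/
def leftSet (x : PGame.{u}) : Set PGame.{u} := Set.range x.moveLeft

/-- `R_x`, the set of right options. -/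
def rightSet (x : PGame.{u}) : Set PGame.{u} := Set.range x.moveRight

/-- `0 = { | }`. -/
instance : Zero PGame.{u} := ⟨mk PEmpty PEmpty PEmpty.elim PEmpty.elim⟩

instance : Inhabited PGame.{u} := ⟨0⟩

/-! ### Order -/

/-- The pair of propositions `(x ≤ y, y ≤ x)`, by simultaneous recursion on `x` and `y`. -/
def leGe (x : PGame.{u}) : PGame.{u} → Prop × Prop :=
  PGame.rec (motive := fun _ => PGame.{u} → Prop × Prop)
    (fun _ _ _ _ ihL ihR y =>
      PGame.rec (motive := fun _ => Prop × Prop)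
        (fun yl yr yL yR ihL' ihR' =>
          ((∀ i, ¬ (ihL i (mk yl yr yL yR)).2) ∧ (∀ j, ¬ (ihR' j).2),
           (∀ j, ¬ (ihL' j).1) ∧ (∀ i, ¬ (ihR i (mk yl yr yL yR)).1))) y) x

/-- Conway's comparison; see `PGame.le_iff` for its recursive characterization. -/
instance : LE PGame.{u} := ⟨fun x y => (leGe x y).1⟩

/-- `x < y` means `x ≤ y` and not `y ≤ x`. -/
instance : LT PGame.{u} := ⟨fun x y => x ≤ y ∧ ¬ y ≤ x⟩

/-- `x ≈ y` means `x ≤ y` and `y ≤ x`. -/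
instance : HasEquiv PGame.{u} := ⟨fun x y => x ≤ y ∧ y ≤ x⟩

theorem leGe_swap (x y : PGame.{u}) : (leGe x y).2 = (leGe y x).1 ∧ (leGe x y).1 = (leGe y x).2 := by
  induction x generalizing y with
  | mk xl xr xL xR ihL ihR =>
    induction y with
    | mk yl yr yL yR ihL' ihR' =>
      constructor
      · show ((∀ j, ¬ (leGe (mk xl xr xL xR) (yL j)).1) ∧
            (∀ i, ¬ (leGe (xR i) (mk yl yr yL yR)).1)) =
          ((∀ i, ¬ (leGe (yL i) (mk xl xr xL xR)).2) ∧
            (∀ j, ¬ (leGe (mk yl yr yL yR) (xR j)).2))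
        simp only [(ihL' _).2, (ihR _ _).2]
      · show ((∀ i, ¬ (leGe (xL i) (mk yl yr yL yR)).2) ∧
            (∀ j, ¬ (leGe (mk xl xr xL xR) (yR j)).2)) =
          ((∀ j, ¬ (leGe (mk yl yr yL yR) (xL j)).1) ∧
            (∀ i, ¬ (leGe (yR i) (mk xl xr xL xR)).1))
        simp only [(ihL _ _).1, (ihR' _).1]

/-- `x ≤ y` iff `y ≤ x^L` for no left option `x^L` and `y^R ≤ x` for no right option `y^R`. -/
theorem le_iff (x y : PGame.{u}) :
    x ≤ y ↔ (∀ i, ¬ y ≤ x.moveLeft i) ∧ (∀ j, ¬ y.moveRight j ≤ x) := by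
  cases x with
  | mk xl xr xL xR =>
    cases y with
    | mk yl yr yL yR =>
      show ((∀ i, ¬ (leGe (xL i) (mk yl yr yL yR)).2) ∧
            (∀ j, ¬ (leGe (mk xl xr xL xR) (yR j)).2)) ↔
          ((∀ i, ¬ (leGe (mk yl yr yL yR) (xL i)).1) ∧
            (∀ j, ¬ (leGe (yR j) (mk xl xr xL xR)).1))
      simp only [(leGe_swap _ _).1]

/-- `x = {L | R}` is a surreal number: all its options are surreal numbers and no right option is
`≤` a left option. -/
def IsSurreal : PGame.{u} → Prop
  | mk _ _ L R => (∀ i j, ¬ R j ≤ L i) ∧ (∀ i, IsSurreal (L i)) ∧ (∀ j, IsSurreal (R j))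

/-- The birthday `𝔟 x`: the least ordinal larger than the birthdays of all options of `x`. -/
def birthday : PGame.{u} → Ordinal.{u}
  | mk _ _ L R =>
    max (⨆ i, Order.succ (birthday (L i))) (⨆ j, Order.succ (birthday (R j)))

/-! ### Arithmetic -/

/-- `-x = {-x^R | -x^L}`. -/
def neg : PGame.{u} → PGame.{u}
  | mk α β L R => mk β α (fun j => neg (R j)) (fun i => neg (L i))

instance : Neg PGame.{u} := ⟨neg⟩

/-- `x + y = {x^L + y, x + y^L | x^R + y, x + y^R}`. -/
def add (x : PGame.{u}) : PGame.{u} → PGame.{u} :=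
  PGame.rec (motive := fun _ => PGame.{u} → PGame.{u})
    (fun xl xr _ _ ihL ihR y =>
      PGame.rec (motive := fun _ => PGame.{u})
        (fun yl yr yL yR ihL' ihR' =>
          mk (xl ⊕ yl) (xr ⊕ yr)
            (Sum.elim (fun i => ihL i (mk yl yr yL yR)) ihL')
            (Sum.elim (fun i => ihR i (mk yl yr yL yR)) ihR')) y) x

instance : Add PGame.{u} := ⟨add⟩

theorem mk_add_mk (xl xr yl yr : Type u) (xL : xl → PGame.{u}) (xR : xr → PGame.{u})
    (yL : yl → PGame.{u}) (yR : yr → PGame.{u}) :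
    mk xl xr xL xR + mk yl yr yL yR =
      mk (xl ⊕ yl) (xr ⊕ yr)
        (Sum.elim (fun i => xL i + mk yl yr yL yR) (fun j => mk xl xr xL xR + yL j))
        (Sum.elim (fun i => xR i + mk yl yr yL yR) (fun j => mk xl xr xL xR + yR j)) :=
  rfl

instance : Sub PGame.{u} := ⟨fun x y => x + -y⟩

/-- `x * y = {x^L y + x y^L - x^L y^L, x^R y + x y^R - x^R y^R |
x^L y + x y^R - x^L y^R, x^R y + x y^L - x^R y^L}`. -/
def mul (x : PGame.{u}) : PGame.{u} → PGame.{u} :=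
  PGame.rec (motive := fun _ => PGame.{u} → PGame.{u})
    (fun xl xr _ _ ihL ihR y =>
      PGame.rec (motive := fun _ => PGame.{u})
        (fun yl yr yL yR ihL' ihR' =>
          mk ((xl × yl) ⊕ (xr × yr)) ((xl × yr) ⊕ (xr × yl))
            (Sum.elim
              (fun p => ihL p.1 (mk yl yr yL yR) + ihL' p.2 - ihL p.1 (yL p.2))
              (fun p => ihR p.1 (mk yl yr yL yR) + ihR' p.2 - ihR p.1 (yR p.2)))
            (Sum.elim
              (fun p => ihL p.1 (mk yl yr yL yR) + ihR' p.2 - ihL p.1 (yR p.2))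
              (fun p => ihR p.1 (mk yl yr yL yR) + ihL' p.2 - ihR p.1 (yL p.2)))) y) x

instance : Mul PGame.{u} := ⟨mul⟩

theorem mk_mul_mk (xl xr yl yr : Type u) (xL : xl → PGame.{u}) (xR : xr → PGame.{u})
    (yL : yl → PGame.{u}) (yR : yr → PGame.{u}) :
    mk xl xr xL xR * mk yl yr yL yR =
      mk ((xl × yl) ⊕ (xr × yr)) ((xl × yr) ⊕ (xr × yl))
        (Sum.elim
          (fun p => xL p.1 * mk yl yr yL yR + mk xl xr xL xR * yL p.2 - xL p.1 * yL p.2)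
          (fun p => xR p.1 * mk yl yr yL yR + mk xl xr xL xR * yR p.2 - xR p.1 * yR p.2))
        (Sum.elim
          (fun p => xL p.1 * mk yl yr yL yR + mk xl xr xL xR * yR p.2 - xL p.1 * yR p.2)
          (fun p => xR p.1 * mk yl yr yL yR + mk xl xr xL xR * yL p.2 - xR p.1 * yL p.2)) :=
  rfl

open Classical in
/-- `|x|`, which is `x` if `0 ≤ x` and `-x` otherwise. -/
def absVal (x : PGame.{u}) : PGame.{u} := if 0 ≤ x then x else -x

/-! ### Canonical representatives -/

/-- The Hessenberg (natural) sum of ordinals. -/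
def hessenbergAdd (a b : Ordinal.{u}) : Ordinal.{u} :=
  max (⨆ a' : Set.Iio a, Order.succ (hessenbergAdd a'.1 b))
    (⨆ b' : Set.Iio b, Order.succ (hessenbergAdd a b'.1))
termination_by (a, b)
decreasing_by
  · exact Prod.Lex.left _ _ a'.2
  · exact Prod.Lex.right _ b'.2

/-- The Hessenberg sum of the cardinalities of `L_x` and `R_x`. -/
def optionSize (x : PGame.{u}) : Ordinal.{u + 1} :=
  hessenbergAdd (Cardinal.mk x.leftSet).ord (Cardinal.mk x.rightSet).ord

/-- The smallest birthday of a surreal number equivalent to `x`. -/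
def bornEq (x : PGame.{u}) : Ordinal.{u} :=
  sInf {α | ∃ y : PGame.{u}, y.IsSurreal ∧ y ≈ x ∧ y.birthday = α}

/-- The youngest surreal numbers equivalent to `x`. -/
def bornEqSet (x : PGame.{u}) : Set PGame.{u} :=
  {y | y.IsSurreal ∧ y ≈ x ∧ y.birthday = bornEq x}

/-- The elements all of whose left and right options belong to `X`. -/
def madeOf (X : Set PGame.{u}) : Set PGame.{u} :=
  {y | (∀ i, y.moveLeft i ∈ X) ∧ (∀ j, y.moveRight j ∈ X)}

/-- A chosen element of `Y` among those of smallest `optionSize`; the choice depends only on the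
set `Y`. It is used for nonempty `Y` only. -/
def chooseSmallest (Y : Set PGame.{u}) : PGame.{u} :=
  Classical.epsilon fun c => c ∈ Y ∧ ∀ d ∈ Y, c.optionSize ≤ d.optionSize

/-- The set of canonical representatives of birthday at most `α`: those of birthday `< α` together
with, for every class of surreal numbers whose youngest members have birthday exactly `α`, a chosen
youngest member all of whose options are canonical representatives of birthday `< α`, with
smallest option sets. -/
def canonicalUpTo (α : Ordinal.{u}) : Set PGame.{u} :=
  {x | x ∈ ⋃ β : Set.Iio α, canonicalUpTo β.1} ∪
  {x | x.IsSurreal ∧ α = bornEq x ∧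
    (bornEqSet x ∩ madeOf (⋃ β : Set.Iio α, canonicalUpTo β.1)).Nonempty ∧
    x = chooseSmallest (bornEqSet x ∩ madeOf (⋃ β : Set.Iio α, canonicalUpTo β.1))}
termination_by α
decreasing_by all_goals exact β.2

/-- `x` is the canonical representative of its equivalence class (a `uSurreal`). -/
def IsUSurreal (x : PGame.{u}) : Prop := ∃ α : Ordinal.{u}, x ∈ canonicalUpTo α

/-- The canonical representative of the class of `x`. -/
def uniq (x : PGame.{u}) : PGame.{u} := Classical.epsilon fun y => y.IsUSurreal ∧ y ≈ x

/-! ### Integers, dyadic numbers, reals -/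

/-- `s_ℤ(n)` for `n ≥ 0`. -/
def ofNat : ℕ → PGame.{u}
  | 0 => 0
  | n + 1 => mk PUnit PEmpty (fun _ => ofNat n) PEmpty.elim

/-- `s_ℤ(-n)` for `n ≥ 0`. -/
def ofNegNat : ℕ → PGame.{u}
  | 0 => 0
  | n + 1 => mk PEmpty PUnit PEmpty.elim (fun _ => ofNegNat n)

/-- `s_ℤ`: `s_ℤ(0) = 0`, `s_ℤ(i) = {s_ℤ(i-1) | }` for `i > 0`, `s_ℤ(i) = { | s_ℤ(i+1)}` for
`i < 0`. -/
def ofInt : ℤ → PGame.{u}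
  | Int.ofNat n => ofNat n
  | Int.negSucc n => ofNegNat (n + 1)

/-- `ofDyadic p j` is `s_𝔻(j / 2 ^ p)`: for `j = 2 k + 1` it is
`{s_𝔻(k / 2 ^ (p - 1)) | s_𝔻((k + 1) / 2 ^ (p - 1))}`, and for `j = 2 k` the fraction is
reduced. -/
def ofDyadic : ℕ → ℤ → PGame.{u}
  | 0, j => ofInt j
  | p + 1, j =>
    if Even j then ofDyadic p (j / 2)
    else mk PUnit PUnit (fun _ => ofDyadic p (j / 2)) (fun _ => ofDyadic p (j / 2 + 1))

/-- `s_ℝ(r)`: the canonical representative of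
`{s_𝔻(⌈r 2 ^ n - 1⌉ / 2 ^ n) | s_𝔻(⌊r 2 ^ n + 1⌋ / 2 ^ n)}`, `n` ranging over `ℕ`. -/
def ofReal (r : ℝ) : PGame.{u} :=
  uniq (mk (ULift.{u} ℕ) (ULift.{u} ℕ)
    (fun n => ofDyadic n.down ⌈r * 2 ^ n.down - 1⌉)
    (fun n => ofDyadic n.down ⌊r * 2 ^ n.down + 1⌋))

/-! ### Powers of omega and transfinite sums -/

/-- `ω^x = {0, s_ℝ(r) * ω^(x^L) | s_ℝ(s) * ω^(x^R)}`, `r` and `s` ranging over the positive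
reals. -/
def omegaPow : PGame.{u} → PGame.{u}
  | mk α β L R =>
    mk (Option (α × ULift.{u} {r : ℝ // 0 < r})) (β × ULift.{u} {r : ℝ // 0 < r})
      (fun o => o.elim 0 fun p => ofReal p.2.down.1 * omegaPow (L p.1))
      (fun p => ofReal p.2.down.1 * omegaPow (R p.1))

/-- `x` is infinitely less than `y`: `x * s_ℤ(n) < y` for all positive integers `n`. -/
def InfLess (x y : PGame.{u}) : Prop := ∀ n : ℕ, n ≠ 0 → x * ofInt (n : ℤ) < y

/-- `x` is a `(γ, s, y, r)`-term: `|x - (s_γ + s_ℝ(r_γ) ω^(y_γ))|` is infinitely less than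
`ω^(y_γ)`. -/
def IsTerm (γ : Ordinal.{u}) (s y : Ordinal.{u} → PGame.{u}) (r : Ordinal.{u} → ℝ)
    (x : PGame.{u}) : Prop :=
  InfLess (absVal (x - (s γ + ofReal (r γ) * omegaPow (y γ)))) (omegaPow (y γ))

/-- `x` is a surreal number that is a `(γ, s, y, r)`-term for every `γ < β`. -/
def InTerms (β : Ordinal.{u}) (s y : Ordinal.{u} → PGame.{u}) (r : Ordinal.{u} → ℝ)
    (x : PGame.{u}) : Prop :=
  x.IsSurreal ∧ ∀ γ < β, IsTerm γ s y r x

/-- The triple `s, y, r` is simplest on `β`: `s_0` is zero, and for `β > 0` the number `s_β` is the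
canonical representative that is a `(γ, s, y, r)`-term for every `γ < β` and is born strictly
before all other such canonical representatives. -/
def SimplestOn (β : Ordinal.{u}) (s y : Ordinal.{u} → PGame.{u}) (r : Ordinal.{u} → ℝ) : Prop :=
  (β = 0 → s β ≈ 0) ∧
  (0 < β → (s β).IsUSurreal ∧ InTerms β s y r (s β) ∧
    ∀ a : PGame.{u}, a.IsUSurreal → a ≠ s β → InTerms β s y r a → (s β).birthday < a.birthday)

/-- `r` and `y`, restricted to the indices `β < θ`, are a sequence of nonzero reals and a strictly
decreasing sequence of canonical representatives. -/
def IsSeries (θ : Ordinal.{u}) (y : Ordinal.{u} → PGame.{u}) (r : Ordinal.{u} → ℝ) : Prop :=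
  (∀ β < θ, r β ≠ 0) ∧ (∀ β < θ, (y β).IsUSurreal) ∧ (∀ β γ, β < γ → γ < θ → y γ < y β)

/-- `z` is the transfinite sum `∑_{β < θ} ω^(y_β) * s_ℝ(r_β)`: the last entry `s_θ` of a sequence
`(s_β)_{β ≤ θ}` of canonical representatives that is simplest on every `β ≤ θ`. -/
def IsSum (θ : Ordinal.{u}) (y : Ordinal.{u} → PGame.{u}) (r : Ordinal.{u} → ℝ)
    (z : PGame.{u}) : Prop :=
  ∃ s : Ordinal.{u} → PGame.{u},
    (∀ β ≤ θ, (s β).IsUSurreal) ∧ (∀ β ≤ θ, SimplestOn β s y r) ∧ z = s θ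

end

end PGame

/-! The normal form comes from repeatedly splitting off leading terms. Modulo equivalence the
surreal numbers form a linearly ordered commutative ring. There, every positive `x` is commensurate
with a power `ω^y` (`exists_commensurate_omegaPow`): each lies below a natural multiple of the
other. A Dedekind cut of the rationals then gives a real `r` with `|x - s_ℝ(r) ω^y|` infinitely
smaller than `ω^y`. So every nonzero surreal has a leading term with nonzero coefficient
(`exists_leading_term`), and its coefficient and canonical exponent are unique
(`IsLeading.unique_coeff`, `IsLeading.exponent_le`), because powers of `ω` with inequivalent
exponents are infinitely far apart.

Membership in `I_β` says exactly that, for every `γ < β`, the difference from `s_γ` has leading term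
`s_ℝ(r_γ) ω^(y_γ)` (`isTerm_iff`). Given `x`, recursively let `s_β` be the simplest element of
`I_β`; as long as it is not equivalent to `x`, read off `y_β` and `r_β` from the leading term of `x
- s_β`. Then `x` always lies in `I_β`, and `I_β` is convex, so a simplest element exists
(`exists_isSimplest`) and is born no later than `x`. The birthdays of the `s_β` increase strictly
(`nfSum_birthday_lt`), so the recursion must reach `x` at some first `θ`, which gives both the sum
and the birthday bound.

For uniqueness, any sum equivalent to `x` lies in all of its own classes, so its terms must also be
the leading terms of `x` minus its partial sums. Uniqueness of leading terms and of simplest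
elements makes two such series agree by induction. Neither can be longer: a further term would be a
leading term of zero with nonzero coefficient.

Before this, the ring structure has to be built. Its hard point is that products of surreals are
surreal and respect equivalence and order (`isSurreal_mul_and_mulMono`). -/

namespace PGame

noncomputable section

/-! ### Options -/

/-- The options of `x` on one side: the left ones for `true`, the right ones for `false`. -/
def opt (x : PGame.{u}) : Bool → Set PGame.{u}
  | true => x.leftSet
  | false => x.rightSet

/-- `a` is an option of `x`. -/
def IsOption (a x : PGame.{u}) : Prop := ∃ s, a ∈ x.opt s

theorem opt_induction {P : PGame.{u} → Prop} (ih : ∀ x, (∀ s, ∀ a ∈ x.opt s, P a) → P x)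
    (x : PGame.{u}) : P x := by
  induction x with
  | mk α β L R hL hR =>
    refine ih _ fun s a ha => ?_
    cases s
    · obtain ⟨j, rfl⟩ := ha
      exact hR j
    · obtain ⟨i, rfl⟩ := ha
      exact hL i

theorem forall_opt_true {x : PGame.{u}} {P : PGame.{u} → Prop} :
    (∀ a ∈ x.opt true, P a) ↔ ∀ i, P (x.moveLeft i) := Set.forall_mem_range

theorem forall_opt_false {x : PGame.{u}} {P : PGame.{u} → Prop} :
    (∀ a ∈ x.opt false, P a) ↔ ∀ i, P (x.moveRight i) := Set.forall_mem_range

theorem mem_opt_mk_true {α β : Type u} {L : α → PGame.{u}} {R : β → PGame.{u}} {a : PGame.{u}} :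
    a ∈ (mk α β L R).opt true ↔ ∃ i, L i = a := Iff.rfl

theorem mem_opt_mk_false {α β : Type u} {L : α → PGame.{u}} {R : β → PGame.{u}} {a : PGame.{u}} :
    a ∈ (mk α β L R).opt false ↔ ∃ i, R i = a := Iff.rfl

theorem notMem_opt_zero (s : Bool) (a : PGame.{u}) : a ∉ (0 : PGame.{u}).opt s := by
  cases s <;> rintro ⟨⟨⟩, _⟩

theorem mem_opt_neg {x a : PGame.{u}} {s : Bool} :
    a ∈ (-x).opt s ↔ ∃ b ∈ x.opt (!s), a = -b := by
  cases x
  cases s <;> constructor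
  · rintro ⟨i, rfl⟩; exact ⟨_, ⟨i, rfl⟩, rfl⟩
  · rintro ⟨_, ⟨i, rfl⟩, rfl⟩; exact ⟨i, rfl⟩
  · rintro ⟨i, rfl⟩; exact ⟨_, ⟨i, rfl⟩, rfl⟩
  · rintro ⟨_, ⟨i, rfl⟩, rfl⟩; exact ⟨i, rfl⟩

theorem mem_opt_add {x y a : PGame.{u}} {s : Bool} :
    a ∈ (x + y).opt s ↔ (∃ b ∈ x.opt s, a = b + y) ∨ ∃ c ∈ y.opt s, a = x + c := by
  cases x
  cases y
  cases s <;> constructor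
  · rintro ⟨i | i, rfl⟩
    exacts [.inl ⟨_, ⟨i, rfl⟩, rfl⟩, .inr ⟨_, ⟨i, rfl⟩, rfl⟩]
  · rintro (⟨_, ⟨i, rfl⟩, rfl⟩ | ⟨_, ⟨i, rfl⟩, rfl⟩)
    exacts [⟨.inl i, rfl⟩, ⟨.inr i, rfl⟩]
  · rintro ⟨i | i, rfl⟩
    exacts [.inl ⟨_, ⟨i, rfl⟩, rfl⟩, .inr ⟨_, ⟨i, rfl⟩, rfl⟩]
  · rintro (⟨_, ⟨i, rfl⟩, rfl⟩ | ⟨_, ⟨i, rfl⟩, rfl⟩)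
    exacts [⟨.inl i, rfl⟩, ⟨.inr i, rfl⟩]

theorem mem_opt_mul {x y a : PGame.{u}} {s : Bool} :
    a ∈ (x * y).opt s ↔
      ∃ p, ∃ b ∈ x.opt p, ∃ c ∈ y.opt (p == s), a = b * y + x * c - b * c := by
  cases x
  cases y
  cases s <;> constructor
  · rintro ⟨⟨i, j⟩ | ⟨i, j⟩, rfl⟩
    exacts [⟨true, _, ⟨i, rfl⟩, _, ⟨j, rfl⟩, rfl⟩, ⟨false, _, ⟨i, rfl⟩, _, ⟨j, rfl⟩, rfl⟩]
  · rintro ⟨_ | _, _, ⟨i, rfl⟩, _, ⟨j, rfl⟩, rfl⟩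
    exacts [⟨.inr (i, j), rfl⟩, ⟨.inl (i, j), rfl⟩]
  · rintro ⟨⟨i, j⟩ | ⟨i, j⟩, rfl⟩
    exacts [⟨true, _, ⟨i, rfl⟩, _, ⟨j, rfl⟩, rfl⟩, ⟨false, _, ⟨i, rfl⟩, _, ⟨j, rfl⟩, rfl⟩]
  · rintro ⟨_ | _, _, ⟨i, rfl⟩, _, ⟨j, rfl⟩, rfl⟩
    exacts [⟨.inr (i, j), rfl⟩, ⟨.inl (i, j), rfl⟩]

/-! ### The preorder -/

theorem le_iff_opt {x y : PGame.{u}} :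
    x ≤ y ↔ (∀ a ∈ x.opt true, ¬ y ≤ a) ∧ ∀ b ∈ y.opt false, ¬ b ≤ x := by
  rw [le_iff, forall_opt_true, forall_opt_false]

theorem not_le_iff_opt {x y : PGame.{u}} :
    ¬ x ≤ y ↔ (∃ a ∈ x.opt true, y ≤ a) ∨ ∃ b ∈ y.opt false, b ≤ x := by
  rw [le_iff_opt, not_and_or]
  push Not
  rfl

protected theorem le_refl (x : PGame.{u}) : x ≤ x := by
  induction x using opt_induction with
  | ih x ih =>
    exact le_iff_opt.2 ⟨fun a ha h => (le_iff_opt.1 h).1 a ha (ih _ a ha),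
      fun b hb h => (le_iff_opt.1 h).2 b hb (ih _ b hb)⟩

theorem le_trans_step {x y z : PGame.{u}} (h₁ : ∀ a ∈ x.opt true, y ≤ z → z ≤ a → y ≤ a)
    (h₂ : ∀ b ∈ z.opt false, b ≤ x → x ≤ y → b ≤ y) (hxy : x ≤ y) (hyz : y ≤ z) : x ≤ z :=
  le_iff_opt.2 ⟨fun a ha h => (le_iff_opt.1 hxy).1 a ha (h₁ a ha hyz h),
    fun b hb h => (le_iff_opt.1 hyz).2 b hb (h₂ b hb h hxy)⟩

/-- Replacing an entry of the triple by an option, as in `le_trans_step`, also rotates the triple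
cyclically. All three rotations are therefore proved in one induction. -/
protected theorem le_trans {x y z : PGame.{u}} (hxy : x ≤ y) (hyz : y ≤ z) : x ≤ z := by
  suffices H : ∀ x y z : PGame.{u},
      (x ≤ y → y ≤ z → x ≤ z) ∧ (y ≤ z → z ≤ x → y ≤ x) ∧ (z ≤ x → x ≤ y → z ≤ y) from
    (H x y z).1 hxy hyz
  clear hxy hyz x y z
  intro x
  induction x using opt_induction with
  | ih x ihx =>
  intro y
  induction y using opt_induction with
  | ih y ihy =>
  intro z
  induction z using opt_induction with
  | ih z ihz =>
    exact ⟨le_trans_step (fun a ha => (ihx _ a ha y z).2.1) (fun b hb => (ihz _ b hb).2.2),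
      le_trans_step (fun a ha => (ihy _ a ha z).2.2) (fun b hb => (ihx _ b hb y z).1),
      le_trans_step (fun a ha => (ihz _ a ha).1) (fun b hb => (ihy _ b hb z).2.1)⟩

instance : Preorder PGame.{u} where
  le_refl := PGame.le_refl
  le_trans _ _ _ := PGame.le_trans
  lt_iff_le_not_ge _ _ := Iff.rfl

theorem not_le_left {x a : PGame.{u}} (ha : a ∈ x.opt true) : ¬ x ≤ a :=
  (le_iff_opt.1 le_rfl).1 a ha

theorem not_right_le {x b : PGame.{u}} (hb : b ∈ x.opt false) : ¬ b ≤ x :=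
  (le_iff_opt.1 le_rfl).2 b hb

theorem equiv_refl (x : PGame.{u}) : x ≈ x := ⟨le_rfl, le_rfl⟩

theorem equiv_symm {x y : PGame.{u}} (h : x ≈ y) : y ≈ x := ⟨h.2, h.1⟩

theorem equiv_trans {x y z : PGame.{u}} (h : x ≈ y) (h' : y ≈ z) : x ≈ z :=
  ⟨h.1.trans h'.1, h'.2.trans h.2⟩

theorem le_of_opt {x y : PGame.{u}} (h₁ : ∀ a ∈ x.opt true, ∃ b ∈ y.opt true, a ≤ b)
    (h₂ : ∀ b ∈ y.opt false, ∃ a ∈ x.opt false, a ≤ b) : x ≤ y := by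
  refine le_iff_opt.2 ⟨fun a ha h => ?_, fun b hb h => ?_⟩
  · obtain ⟨b, hb, hab⟩ := h₁ a ha
    exact not_le_left hb (h.trans hab)
  · obtain ⟨a, ha, hab⟩ := h₂ b hb
    exact not_right_le ha (hab.trans h)

theorem equiv_of_opt {x y : PGame.{u}} (h₁ : ∀ s, ∀ a ∈ x.opt s, ∃ b ∈ y.opt s, a ≈ b)
    (h₂ : ∀ s, ∀ b ∈ y.opt s, ∃ a ∈ x.opt s, b ≈ a) : x ≈ y :=
  ⟨le_of_opt (fun a ha => (h₁ _ a ha).imp fun _ h => ⟨h.1, h.2.1⟩)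
      (fun b hb => (h₂ _ b hb).imp fun _ h => ⟨h.1, h.2.2⟩),
    le_of_opt (fun b hb => (h₂ _ b hb).imp fun _ h => ⟨h.1, h.2.1⟩)
      (fun a ha => (h₁ _ a ha).imp fun _ h => ⟨h.1, h.2.2⟩)⟩

/-! ### Negation and addition -/

protected theorem neg_neg (x : PGame.{u}) : - -x = x := by
  induction x with
  | mk α β L R hL hR =>
    show mk α β (fun i => - -(L i)) (fun j => - -(R j)) = _
    simp only [hL, hR]

theorem neg_le_neg_iff' {x y : PGame.{u}} : -y ≤ -x ↔ x ≤ y := by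
  suffices H : ∀ x y : PGame.{u}, (-y ≤ -x ↔ x ≤ y) ∧ (-x ≤ -y ↔ y ≤ x) from (H x y).1
  intro x
  induction x using opt_induction with
  | ih x ihx =>
  intro y
  induction y using opt_induction with
  | ih y ihy =>
    constructor
    · rw [le_iff_opt, @le_iff_opt x, and_comm]
      simp only [mem_opt_neg, forall_exists_index, and_imp]
      refine and_congr ⟨fun h a ha => ?_, fun h a b hb e => ?_⟩ ⟨fun h a ha => ?_, fun h a b hb e => ?_⟩
      · rw [← (ihx _ a ha y).2]; exact h _ a ha rfl
      · subst e; rw [(ihx _ b hb y).2]; exact h b hb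
      · rw [← (ihy _ a ha).2]; exact h _ a ha rfl
      · subst e; rw [(ihy _ b hb).2]; exact h b hb
    · rw [le_iff_opt, @le_iff_opt y, and_comm]
      simp only [mem_opt_neg, forall_exists_index, and_imp]
      refine and_congr ⟨fun h a ha => ?_, fun h a b hb e => ?_⟩ ⟨fun h a ha => ?_, fun h a b hb e => ?_⟩
      · rw [← (ihy _ a ha).1]; exact h _ a ha rfl
      · subst e; rw [(ihy _ b hb).1]; exact h b hb
      · rw [← (ihx _ a ha y).1]; exact h _ a ha rfl
      · subst e; rw [(ihx _ b hb y).1]; exact h b hb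

/-- Passing to an option of `x` or `y` reverses the comparison and uses the converse implication, so
monotonicity and cancellation are proved together, in both orders of `x` and `y`. An option `c` of
`z` is handled by monotonicity for `c`: it would make `y + z` or `x + z` compare wrongly with one of
its own options. -/
theorem add_le_add_iff_right' {x y z : PGame.{u}} : x + z ≤ y + z ↔ x ≤ y := by
  have step : ∀ x y z : PGame.{u}, (∀ s, ∀ a ∈ x.opt s, (y + z ≤ a + z ↔ y ≤ a)) →
      (∀ s, ∀ b ∈ y.opt s, (b + z ≤ x + z ↔ b ≤ x)) →
      (∀ s, ∀ c ∈ z.opt s, (x + c ≤ y + c ↔ x ≤ y)) → (x + z ≤ y + z ↔ x ≤ y) := by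
    intro x y z hx hy hz
    constructor
    · intro h
      refine le_iff_opt.2 ⟨fun a ha h' => ?_, fun b hb h' => ?_⟩
      · exact (le_iff_opt.1 h).1 _ (mem_opt_add.2 (.inl ⟨a, ha, rfl⟩)) ((hx _ a ha).2 h')
      · exact (le_iff_opt.1 h).2 _ (mem_opt_add.2 (.inl ⟨b, hb, rfl⟩)) ((hy _ b hb).2 h')
    · intro h
      refine le_iff_opt.2 ⟨fun a ha h' => ?_, fun b hb h' => ?_⟩
      · obtain ⟨a, ha', rfl⟩ | ⟨c, hc, rfl⟩ := mem_opt_add.1 ha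
        · exact (le_iff_opt.1 h).1 a ha' ((hx _ a ha').1 h')
        · exact (le_iff_opt.1 h').1 _ (mem_opt_add.2 (.inr ⟨c, hc, rfl⟩)) ((hz _ c hc).2 h)
      · obtain ⟨b, hb', rfl⟩ | ⟨c, hc, rfl⟩ := mem_opt_add.1 hb
        · exact (le_iff_opt.1 h).2 b hb' ((hy _ b hb').1 h')
        · exact (le_iff_opt.1 h').2 _ (mem_opt_add.2 (.inr ⟨c, hc, rfl⟩)) ((hz _ c hc).2 h)
  suffices H : ∀ x y z : PGame.{u}, (x + z ≤ y + z ↔ x ≤ y) ∧ (y + z ≤ x + z ↔ y ≤ x) from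
    (H x y z).1
  intro x
  induction x using opt_induction with
  | ih x ihx =>
  intro y
  induction y using opt_induction with
  | ih y ihy =>
  intro z
  induction z using opt_induction with
  | ih z ihz =>
    exact ⟨step _ _ _ (fun s a ha => (ihx s a ha y z).2) (fun s b hb => (ihy s b hb z).2)
      (fun s c hc => (ihz s c hc).1),
      step _ _ _ (fun s b hb => (ihy s b hb z).1) (fun s a ha => (ihx s a ha y z).1)
      (fun s c hc => (ihz s c hc).2)⟩

theorem add_comm_equiv (x y : PGame.{u}) : x + y ≈ y + x := by
  induction x using opt_induction generalizing y with
  | ih x ihx =>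
  induction y using opt_induction with
  | ih y ihy =>
    refine equiv_of_opt (fun s w hw => ?_) (fun s w hw => ?_)
    · obtain ⟨a, ha, rfl⟩ | ⟨a, ha, rfl⟩ := mem_opt_add.1 hw
      · exact ⟨_, mem_opt_add.2 (.inr ⟨a, ha, rfl⟩), ihx s a ha y⟩
      · exact ⟨_, mem_opt_add.2 (.inl ⟨a, ha, rfl⟩), ihy s a ha⟩
    · obtain ⟨a, ha, rfl⟩ | ⟨a, ha, rfl⟩ := mem_opt_add.1 hw
      · exact ⟨_, mem_opt_add.2 (.inr ⟨a, ha, rfl⟩), equiv_symm (ihy s a ha)⟩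
      · exact ⟨_, mem_opt_add.2 (.inl ⟨a, ha, rfl⟩), equiv_symm (ihx s a ha y)⟩

theorem add_assoc_equiv (x y z : PGame.{u}) : x + y + z ≈ x + (y + z) := by
  induction x using opt_induction generalizing y z with
  | ih x ihx =>
  induction y using opt_induction generalizing z with
  | ih y ihy =>
  induction z using opt_induction with
  | ih z ihz =>
    refine equiv_of_opt (fun s w hw => ?_) (fun s w hw => ?_)
    · obtain ⟨v, hv, rfl⟩ | ⟨c, hc, rfl⟩ := mem_opt_add.1 hw
      · obtain ⟨a, ha, rfl⟩ | ⟨b, hb, rfl⟩ := mem_opt_add.1 hv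
        · exact ⟨_, mem_opt_add.2 (.inl ⟨a, ha, rfl⟩), ihx s a ha y z⟩
        · exact ⟨_, mem_opt_add.2 (.inr ⟨_, mem_opt_add.2 (.inl ⟨b, hb, rfl⟩), rfl⟩), ihy s b hb z⟩
      · exact ⟨_, mem_opt_add.2 (.inr ⟨_, mem_opt_add.2 (.inr ⟨c, hc, rfl⟩), rfl⟩), ihz s c hc⟩
    · obtain ⟨a, ha, rfl⟩ | ⟨v, hv, rfl⟩ := mem_opt_add.1 hw
      · exact ⟨_, mem_opt_add.2 (.inl ⟨_, mem_opt_add.2 (.inl ⟨a, ha, rfl⟩), rfl⟩),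
          equiv_symm (ihx s a ha y z)⟩
      · obtain ⟨b, hb, rfl⟩ | ⟨c, hc, rfl⟩ := mem_opt_add.1 hv
        · exact ⟨_, mem_opt_add.2 (.inl ⟨_, mem_opt_add.2 (.inr ⟨b, hb, rfl⟩), rfl⟩),
            equiv_symm (ihy s b hb z)⟩
        · exact ⟨_, mem_opt_add.2 (.inr ⟨c, hc, rfl⟩), equiv_symm (ihz s c hc)⟩

theorem zero_add_equiv (x : PGame.{u}) : 0 + x ≈ x := by
  induction x using opt_induction with
  | ih x ih =>
    refine equiv_of_opt (fun s w hw => ?_) (fun s a ha => ?_)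
    · obtain ⟨a, ha, rfl⟩ | ⟨a, ha, rfl⟩ := mem_opt_add.1 hw
      · exact (notMem_opt_zero _ _ ha).elim
      · exact ⟨a, ha, ih s a ha⟩
    · exact ⟨_, mem_opt_add.2 (.inr ⟨a, ha, rfl⟩), equiv_symm (ih s a ha)⟩

theorem neg_add_cancel_equiv (x : PGame.{u}) : -x + x ≈ 0 := by
  induction x using opt_induction with
  | ih x ih =>
    refine ⟨le_iff_opt.2 ⟨fun w hw h => ?_, fun b hb => (notMem_opt_zero _ _ hb).elim⟩,
      le_iff_opt.2 ⟨fun b hb => (notMem_opt_zero _ _ hb).elim, fun w hw h => ?_⟩⟩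
    · obtain ⟨a, ha, rfl⟩ | ⟨a, ha, rfl⟩ := mem_opt_add.1 hw
      · obtain ⟨b, hb, rfl⟩ := mem_opt_neg.1 ha
        exact (le_iff_opt.1 h).2 _ (mem_opt_add.2 (.inr ⟨b, hb, rfl⟩)) (ih _ b hb).1
      · exact (le_iff_opt.1 h).2 _
          (mem_opt_add.2 (.inl ⟨_, mem_opt_neg.2 ⟨a, ha, rfl⟩, rfl⟩)) (ih _ a ha).1
    · obtain ⟨a, ha, rfl⟩ | ⟨a, ha, rfl⟩ := mem_opt_add.1 hw
      · obtain ⟨b, hb, rfl⟩ := mem_opt_neg.1 ha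
        exact (le_iff_opt.1 h).1 _ (mem_opt_add.2 (.inr ⟨b, hb, rfl⟩)) (ih _ b hb).2
      · exact (le_iff_opt.1 h).1 _
          (mem_opt_add.2 (.inl ⟨_, mem_opt_neg.2 ⟨a, ha, rfl⟩, rfl⟩)) (ih _ a ha).2

theorem add_le_add_iff_left' {x y z : PGame.{u}} : z + x ≤ z + y ↔ x ≤ y := by
  rw [← @add_le_add_iff_right' x y z]
  exact ⟨fun h => ((add_comm_equiv x z).1.trans h).trans (add_comm_equiv z y).1,
    fun h => ((add_comm_equiv z x).1.trans h).trans (add_comm_equiv y z).1⟩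

/-! ### The group of games -/

/-- Equivalence of games, as a setoid. -/
def gameSetoid : Setoid PGame.{u} :=
  ⟨fun x y => x ≈ y, equiv_refl, equiv_symm, equiv_trans⟩

/-- Games: formal expressions modulo equivalence. -/
def Game : Type (u + 1) := Quotient gameSetoid.{u}

/-- The class of `x`. -/
def gm (x : PGame.{u}) : Game.{u} := Quotient.mk gameSetoid x

theorem gm_eq_iff {x y : PGame.{u}} : gm x = gm y ↔ x ≈ y :=
  ⟨fun h => Quotient.exact (s := gameSetoid) h, fun h => Quotient.sound (s := gameSetoid) h⟩

theorem Game.ind {P : Game.{u} → Prop} (h : ∀ x, P (gm x)) (g : Game.{u}) : P g :=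
  Quotient.ind h g

instance : LE Game.{u} := ⟨Quotient.lift₂ (· ≤ ·) fun _ _ _ _ h h' =>
  propext ⟨fun H => (h.2.trans H).trans h'.1, fun H => (h.1.trans H).trans h'.2⟩⟩

theorem gm_le_iff {x y : PGame.{u}} : gm x ≤ gm y ↔ x ≤ y := Iff.rfl

instance : PartialOrder Game.{u} where
  le_refl := Game.ind fun x => le_refl x
  le_trans := Game.ind fun _ => Game.ind fun _ => Game.ind fun _ => PGame.le_trans
  le_antisymm := Game.ind fun _ => Game.ind fun _ => fun h h' => gm_eq_iff.2 ⟨h, h'⟩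

theorem gm_lt_iff {x y : PGame.{u}} : gm x < gm y ↔ x < y := Iff.rfl

instance : Zero Game.{u} := ⟨gm 0⟩

instance : Neg Game.{u} := ⟨Quotient.map Neg.neg fun _ _ h =>
  ⟨neg_le_neg_iff'.2 h.2, neg_le_neg_iff'.2 h.1⟩⟩

instance : Add Game.{u} := ⟨Quotient.map₂ (· + ·) fun _ _ h _ _ h' =>
  ⟨(add_le_add_iff_right'.2 h.1).trans (add_le_add_iff_left'.2 h'.1),
    (add_le_add_iff_right'.2 h.2).trans (add_le_add_iff_left'.2 h'.2)⟩⟩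

theorem gm_zero : gm (0 : PGame.{u}) = 0 := rfl

theorem gm_neg (x : PGame.{u}) : gm (-x) = -gm x := rfl

theorem gm_add (x y : PGame.{u}) : gm (x + y) = gm x + gm y := rfl

instance : AddCommGroup Game.{u} where
  add_assoc := Game.ind fun _ => Game.ind fun _ => Game.ind fun _ =>
    gm_eq_iff.2 (add_assoc_equiv _ _ _)
  add_comm := Game.ind fun _ => Game.ind fun _ => gm_eq_iff.2 (add_comm_equiv _ _)
  zero_add := Game.ind fun _ => gm_eq_iff.2 (zero_add_equiv _)
  add_zero := Game.ind fun _ => gm_eq_iff.2 (equiv_trans (add_comm_equiv _ _) (zero_add_equiv _))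
  neg_add_cancel := Game.ind fun _ => gm_eq_iff.2 (neg_add_cancel_equiv _)
  nsmul := nsmulRec
  zsmul := zsmulRec

theorem gm_sub (x y : PGame.{u}) : gm (x - y) = gm x - gm y :=
  (sub_eq_add_neg (gm x) (gm y)).symm

instance : IsOrderedAddMonoid Game.{u} where
  add_le_add_left := Game.ind fun _ => Game.ind fun _ h => Game.ind fun _ =>
    add_le_add_iff_right'.2 h

theorem gm_eq_of_opt {x y : PGame.{u}} (h₁ : ∀ s, ∀ a ∈ x.opt s, ∃ b ∈ y.opt s, gm a = gm b)
    (h₂ : ∀ s, ∀ b ∈ y.opt s, ∃ a ∈ x.opt s, gm b = gm a) : gm x = gm y := by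
  simp only [gm_eq_iff] at *
  exact equiv_of_opt h₁ h₂

/-! ### Multiplication of games -/

/-- Multiplication does not respect equivalence of arbitrary games. The ring laws are therefore
identities in the additive group `Game` between classes of products of formal expressions, and no
product on `Game` is defined. -/
theorem gm_mul_opt (a b x y : PGame.{u}) :
    gm (a * y + x * b - a * b) = gm (a * y) + gm (x * b) - gm (a * b) := by
  rw [gm_sub, gm_add]

theorem gm_mul_comm (x y : PGame.{u}) : gm (x * y) = gm (y * x) := by
  induction x using opt_induction generalizing y with
  | ih x ihx =>
  induction y using opt_induction with
  | ih y ihy =>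
    have key : ∀ p q, ∀ a ∈ x.opt p, ∀ b ∈ y.opt q,
        gm (a * y + x * b - a * b) = gm (b * x + y * a - b * a) := by
      intro p q a ha b hb
      rw [gm_mul_opt, gm_mul_opt, ihx p a ha, ihx p a ha, ihy q b hb, add_comm (gm (y * a))]
    refine gm_eq_of_opt (fun s w hw => ?_) (fun s w hw => ?_)
    · obtain ⟨p, a, ha, b, hb, rfl⟩ := mem_opt_mul.1 hw
      exact ⟨_, mem_opt_mul.2 ⟨_, b, hb, a, by cases p <;> cases s <;> exact ha, rfl⟩,
        key _ _ a ha b hb⟩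
    · obtain ⟨p, b, hb, a, ha, rfl⟩ := mem_opt_mul.1 hw
      exact ⟨_, mem_opt_mul.2 ⟨_, a, ha, b, by cases p <;> cases s <;> exact hb, rfl⟩,
        (key _ _ a ha b hb).symm⟩

theorem gm_zero_mul (x : PGame.{u}) : gm (0 * x) = 0 := by
  rw [← gm_zero]
  refine gm_eq_of_opt (fun s w hw => ?_) (fun s w hw => (notMem_opt_zero _ _ hw).elim)
  obtain ⟨p, a, ha, _⟩ := mem_opt_mul.1 hw
  exact (notMem_opt_zero _ _ ha).elim

theorem gm_mul_zero (x : PGame.{u}) : gm (x * 0) = 0 := by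
  rw [gm_mul_comm, gm_zero_mul]

theorem gm_neg_mul (x y : PGame.{u}) : gm (-x * y) = -gm (x * y) := by
  rw [← gm_neg]
  induction x using opt_induction generalizing y with
  | ih x ihx =>
  induction y using opt_induction with
  | ih y ihy =>
    have key : ∀ p q, ∀ a ∈ x.opt p, ∀ b ∈ y.opt q,
        gm (-a * y + -x * b - -a * b) = gm (-(a * y + x * b - a * b)) := by
      intro p q a ha b hb
      rw [gm_neg, gm_mul_opt, gm_mul_opt, ihx p a ha, ihx p a ha, ihy q b hb]
      simp only [gm_neg]
      abel
    refine gm_eq_of_opt (fun s w hw => ?_) (fun s w hw => ?_)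
    · obtain ⟨p, a, ha, b, hb, rfl⟩ := mem_opt_mul.1 hw
      obtain ⟨a, ha', rfl⟩ := mem_opt_neg.1 ha
      exact ⟨_, mem_opt_neg.2 ⟨_, mem_opt_mul.2 ⟨_, a, ha', b,
        by cases p <;> cases s <;> exact hb, rfl⟩, rfl⟩, key _ _ a ha' b hb⟩
    · obtain ⟨v, hv, rfl⟩ := mem_opt_neg.1 hw
      obtain ⟨p, a, ha, b, hb, rfl⟩ := mem_opt_mul.1 hv
      exact ⟨_, mem_opt_mul.2 ⟨!p, -a, mem_opt_neg.2 ⟨a, by simpa using ha, rfl⟩, b,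
        by cases p <;> cases s <;> exact hb, rfl⟩, (key _ _ a ha b hb).symm⟩

theorem gm_mul_neg (x y : PGame.{u}) : gm (x * -y) = -gm (x * y) := by
  rw [gm_mul_comm, gm_neg_mul, gm_mul_comm]

theorem gm_mul_add (x y z : PGame.{u}) : gm (x * (y + z)) = gm (x * y) + gm (x * z) := by
  rw [← gm_add]
  induction x using opt_induction generalizing y z with
  | ih x ihx =>
  induction y using opt_induction generalizing z with
  | ih y ihy =>
  induction z using opt_induction with
  | ih z ihz =>
    have key₁ : ∀ p q, ∀ a ∈ x.opt p, ∀ b ∈ y.opt q,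
        gm (a * (y + z) + x * (b + z) - a * (b + z)) = gm (a * y + x * b - a * b + x * z) := by
      intro p q a ha b hb
      rw [gm_add, gm_mul_opt, gm_mul_opt, ihx p a ha, ihx p a ha, ihy q b hb]
      simp only [gm_add]
      abel
    have key₂ : ∀ p q, ∀ a ∈ x.opt p, ∀ c ∈ z.opt q,
        gm (a * (y + z) + x * (y + c) - a * (y + c)) = gm (x * y + (a * z + x * c - a * c)) := by
      intro p q a ha b hb
      rw [gm_add, gm_mul_opt, gm_mul_opt, ihx p a ha, ihx p a ha, ihz q b hb]
      simp only [gm_add]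
      abel
    refine gm_eq_of_opt (fun s w hw => ?_) (fun s w hw => ?_)
    · obtain ⟨p, a, ha, b, hb, rfl⟩ := mem_opt_mul.1 hw
      obtain ⟨b, hb', rfl⟩ | ⟨b, hb', rfl⟩ := mem_opt_add.1 hb
      · exact ⟨_, mem_opt_add.2 (.inl ⟨_, mem_opt_mul.2 ⟨p, a, ha, b, hb', rfl⟩, rfl⟩),
          key₁ _ _ a ha b hb'⟩
      · exact ⟨_, mem_opt_add.2 (.inr ⟨_, mem_opt_mul.2 ⟨p, a, ha, b, hb', rfl⟩, rfl⟩),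
          key₂ _ _ a ha b hb'⟩
    · obtain ⟨v, hv, rfl⟩ | ⟨v, hv, rfl⟩ := mem_opt_add.1 hw
      · obtain ⟨p, a, ha, b, hb, rfl⟩ := mem_opt_mul.1 hv
        exact ⟨_, mem_opt_mul.2 ⟨p, a, ha, _, mem_opt_add.2 (.inl ⟨b, hb, rfl⟩), rfl⟩,
          (key₁ _ _ a ha b hb).symm⟩
      · obtain ⟨p, a, ha, b, hb, rfl⟩ := mem_opt_mul.1 hv
        exact ⟨_, mem_opt_mul.2 ⟨p, a, ha, _, mem_opt_add.2 (.inr ⟨b, hb, rfl⟩), rfl⟩,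
          (key₂ _ _ a ha b hb).symm⟩

theorem gm_mul_sub (x y z : PGame.{u}) : gm (x * (y - z)) = gm (x * y) - gm (x * z) := by
  rw [sub_eq_add_neg, ← gm_mul_neg]
  exact gm_mul_add x y (-z)

theorem gm_add_mul (x y z : PGame.{u}) : gm ((x + y) * z) = gm (x * z) + gm (y * z) := by
  rw [gm_mul_comm, gm_mul_add, gm_mul_comm z x, gm_mul_comm z y]

theorem gm_sub_mul (x y z : PGame.{u}) : gm ((x - y) * z) = gm (x * z) - gm (y * z) := by
  rw [gm_mul_comm, gm_mul_sub, gm_mul_comm z x, gm_mul_comm z y]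

instance : One PGame.{u} := ⟨ofNat 1⟩

theorem zero_mem_opt_one : (0 : PGame.{u}) ∈ (1 : PGame.{u}).opt true := ⟨PUnit.unit, rfl⟩

theorem eq_of_mem_opt_one {s : Bool} {a : PGame.{u}} (h : a ∈ (1 : PGame.{u}).opt s) :
    s = true ∧ a = 0 := by
  cases s
  · obtain ⟨⟨⟩, _⟩ := h
  · obtain ⟨_, rfl⟩ := h
    exact ⟨rfl, rfl⟩

theorem gm_mul_one (x : PGame.{u}) : gm (x * 1) = gm x := by
  induction x using opt_induction with
  | ih x ihx =>
    have key : ∀ p, ∀ a ∈ x.opt p, gm (a * 1 + x * 0 - a * 0) = gm a := by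
      intro p a ha
      rw [gm_mul_opt, ihx p a ha, gm_mul_zero, gm_mul_zero, add_zero, sub_zero]
    refine gm_eq_of_opt (fun s w hw => ?_) (fun s a ha => ?_)
    · obtain ⟨p, a, ha, b, hb, rfl⟩ := mem_opt_mul.1 hw
      obtain ⟨hp, rfl⟩ := eq_of_mem_opt_one hb
      obtain rfl : p = s := by simpa using hp
      exact ⟨a, ha, key _ a ha⟩
    · exact ⟨_, mem_opt_mul.2 ⟨s, a, ha, 0, by simpa using zero_mem_opt_one, rfl⟩,
        (key _ a ha).symm⟩

theorem gm_mul_assoc (x y z : PGame.{u}) : gm (x * y * z) = gm (x * (y * z)) := by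
  induction x using opt_induction generalizing y z with
  | ih x ihx =>
  induction y using opt_induction generalizing z with
  | ih y ihy =>
  induction z using opt_induction with
  | ih z ihz =>
    have key : ∀ p q r, ∀ a ∈ x.opt p, ∀ b ∈ y.opt q, ∀ c ∈ z.opt r,
        gm ((a * y + x * b - a * b) * z + x * y * c - (a * y + x * b - a * b) * c) =
          gm (a * (y * z) + x * (b * z + y * c - b * c) - a * (b * z + y * c - b * c)) := by
      intro p q r a ha b hb c hc
      simp only [gm_mul_opt, gm_sub_mul, gm_add_mul, gm_mul_sub, gm_mul_add, ihx p a ha,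
        ihy q b hb, ihz r c hc]
      abel
    refine gm_eq_of_opt (fun s w hw => ?_) (fun s w hw => ?_)
    · obtain ⟨p, v, hv, c, hc, rfl⟩ := mem_opt_mul.1 hw
      obtain ⟨q, a, ha, b, hb, rfl⟩ := mem_opt_mul.1 hv
      exact ⟨_, mem_opt_mul.2 ⟨q, a, ha, _, mem_opt_mul.2 ⟨q == p, b, hb, c,
        by cases p <;> cases q <;> cases s <;> exact hc, rfl⟩, rfl⟩, key _ _ _ a ha b hb c hc⟩
    · obtain ⟨p, a, ha, v, hv, rfl⟩ := mem_opt_mul.1 hw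
      obtain ⟨q, b, hb, c, hc, rfl⟩ := mem_opt_mul.1 hv
      exact ⟨_, mem_opt_mul.2 ⟨p == q, _, mem_opt_mul.2 ⟨p, a, ha, b,
        by cases p <;> cases q <;> exact hb, rfl⟩, c,
        by cases p <;> cases q <;> cases s <;> exact hc, rfl⟩, (key _ _ _ a ha b hb c hc).symm⟩

/-! ### Surreal numbers -/

theorem isSurreal_iff {x : PGame.{u}} : x.IsSurreal ↔
    (∀ a ∈ x.opt true, ∀ b ∈ x.opt false, ¬ b ≤ a) ∧ ∀ s, ∀ a ∈ x.opt s, a.IsSurreal := by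
  cases x with
  | mk α β L R =>
    simp only [IsSurreal, Bool.forall_bool, forall_opt_true, forall_opt_false]
    exact ⟨fun h => ⟨fun i j => h.1 i j, h.2.2, h.2.1⟩, fun h => ⟨fun i j => h.1 i j, h.2.2, h.2.1⟩⟩

theorem IsSurreal.opt {x a : PGame.{u}} (hx : x.IsSurreal) {s : Bool} (ha : a ∈ x.opt s) :
    a.IsSurreal := (isSurreal_iff.1 hx).2 s a ha

theorem left_le_and_le_right {x : PGame.{u}} (hx : x.IsSurreal) :
    (∀ a ∈ x.opt true, a ≤ x) ∧ ∀ b ∈ x.opt false, x ≤ b := by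
  induction x using opt_induction with
  | ih x ih =>
    refine ⟨fun a ha => le_iff_opt.2 ⟨fun c hc h => ?_, fun b hb => ?_⟩,
      fun b hb => le_iff_opt.2 ⟨fun a ha => ?_, fun c hc h => ?_⟩⟩
    · exact not_le_left ha (h.trans ((ih _ a ha (hx.opt ha)).1 c hc))
    · exact (isSurreal_iff.1 hx).1 a ha b hb
    · exact (isSurreal_iff.1 hx).1 a ha b hb
    · exact not_right_le hb (((ih _ b hb (hx.opt hb)).2 c hc).trans h)

theorem IsSurreal.left_lt {x a : PGame.{u}} (hx : x.IsSurreal) (ha : a ∈ x.opt true) : a < x :=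
  ⟨(left_le_and_le_right hx).1 a ha, not_le_left ha⟩

theorem IsSurreal.lt_right {x b : PGame.{u}} (hx : x.IsSurreal) (hb : b ∈ x.opt false) : x < b :=
  ⟨(left_le_and_le_right hx).2 b hb, not_right_le hb⟩

theorem IsSurreal.le_of_not_le {x y : PGame.{u}} (hx : x.IsSurreal) (hy : y.IsSurreal)
    (h : ¬ y ≤ x) : x ≤ y := by
  obtain ⟨a, ha, h⟩ | ⟨b, hb, h⟩ := not_le_iff_opt.1 h
  · exact h.trans (hy.left_lt ha).1
  · exact (hx.lt_right hb).1.trans h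

theorem IsSurreal.lt_of_not_le {x y : PGame.{u}} (hx : x.IsSurreal) (hy : y.IsSurreal)
    (h : ¬ y ≤ x) : x < y := ⟨hx.le_of_not_le hy h, h⟩

theorem isSurreal_of_opt {x : PGame.{u}} (h₁ : ∀ a ∈ x.opt true, ∀ b ∈ x.opt false, a < b)
    (h₂ : ∀ s, ∀ a ∈ x.opt s, a.IsSurreal) : x.IsSurreal :=
  isSurreal_iff.2 ⟨fun a ha b hb => (h₁ a ha b hb).2, h₂⟩

theorem isSurreal_zero : (0 : PGame.{u}).IsSurreal :=
  isSurreal_of_opt (fun _ h => (notMem_opt_zero _ _ h).elim) fun _ _ h => (notMem_opt_zero _ _ h).elim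

theorem isSurreal_one : (1 : PGame.{u}).IsSurreal :=
  isSurreal_of_opt (fun _ _ _ h => absurd (eq_of_mem_opt_one h).1 (by simp))
    fun _ _ h => (eq_of_mem_opt_one h).2 ▸ isSurreal_zero

theorem neg_lt_neg_iff' {x y : PGame.{u}} : -y < -x ↔ x < y :=
  and_congr neg_le_neg_iff' (not_congr neg_le_neg_iff')

theorem IsSurreal.neg {x : PGame.{u}} (hx : x.IsSurreal) : (-x).IsSurreal := by
  induction x using opt_induction with
  | ih x ih =>
    refine isSurreal_of_opt (fun v hv w hw => ?_) (fun s v hv => ?_)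
    · obtain ⟨a, ha, rfl⟩ := mem_opt_neg.1 hv
      obtain ⟨b, hb, rfl⟩ := mem_opt_neg.1 hw
      exact neg_lt_neg_iff'.2 ((hx.left_lt hb).trans (hx.lt_right ha))
    · obtain ⟨a, ha, rfl⟩ := mem_opt_neg.1 hv
      exact ih _ a ha (hx.opt ha)

theorem add_lt_add_of_lt_left {x a : PGame.{u}} (h : a < x) (y : PGame.{u}) : a + y < x + y := by
  rw [← gm_lt_iff, gm_add, gm_add, add_lt_add_iff_right]
  exact h

theorem add_lt_add_of_lt_right {x a : PGame.{u}} (h : a < x) (y : PGame.{u}) : y + a < y + x := by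
  rw [← gm_lt_iff, gm_add, gm_add, add_lt_add_iff_left]
  exact h

theorem IsSurreal.add {x y : PGame.{u}} (hx : x.IsSurreal) (hy : y.IsSurreal) :
    (x + y).IsSurreal := by
  induction x using opt_induction generalizing y with
  | ih x ihx =>
  induction y using opt_induction with
  | ih y ihy =>
    have h₁ : ∀ a ∈ (x + y).opt true, a < x + y := by
      intro w hw
      obtain ⟨a, ha, rfl⟩ | ⟨a, ha, rfl⟩ := mem_opt_add.1 hw
      · exact add_lt_add_of_lt_left (hx.left_lt ha) y
      · exact add_lt_add_of_lt_right (hy.left_lt ha) x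
    have h₂ : ∀ a ∈ (x + y).opt false, x + y < a := by
      intro w hw
      obtain ⟨a, ha, rfl⟩ | ⟨a, ha, rfl⟩ := mem_opt_add.1 hw
      · exact add_lt_add_of_lt_left (hx.lt_right ha) y
      · exact add_lt_add_of_lt_right (hy.lt_right ha) x
    refine isSurreal_of_opt (fun a ha b hb => (h₁ a ha).trans (h₂ b hb)) (fun s w hw => ?_)
    obtain ⟨a, ha, rfl⟩ | ⟨a, ha, rfl⟩ := mem_opt_add.1 hw
    · exact ihx _ a ha (hx.opt ha) hy
    · exact ihy _ a ha (hy.opt ha)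

theorem IsSurreal.sub {x y : PGame.{u}} (hx : x.IsSurreal) (hy : y.IsSurreal) :
    (x - y).IsSurreal := hx.add hy.neg

/-! ### Birthdays of options -/

theorem birthday_le_iff {x : PGame.{u}} {o : Ordinal.{u}} :
    x.birthday ≤ o ↔ ∀ s, ∀ a ∈ x.opt s, a.birthday < o := by
  cases x with
  | mk α β L R =>
    simp only [birthday, max_le_iff, Bool.forall_bool, forall_opt_true, forall_opt_false]
    rw [ciSup_le_iff' (Ordinal.bddAbove_of_small), ciSup_le_iff' (Ordinal.bddAbove_of_small), and_comm]
    simp only [Order.succ_le_iff]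
    rfl

theorem birthday_lt_of_opt {x a : PGame.{u}} {s : Bool} (h : a ∈ x.opt s) :
    a.birthday < x.birthday := birthday_le_iff.1 le_rfl s a h

theorem IsOption.birthday_lt {x a : PGame.{u}} (h : IsOption a x) : a.birthday < x.birthday :=
  h.elim fun _ => birthday_lt_of_opt

theorem IsOption.isSurreal {x a : PGame.{u}} (h : IsOption a x) (hx : x.IsSurreal) :
    a.IsSurreal := h.elim fun _ => hx.opt

/-! ### Products of surreal numbers -/

/-- The expansion of `(x₂ - x₁) * (y₂ - y₁)`. -/
def mulDiff (x₁ x₂ y₁ y₂ : PGame.{u}) : Game.{u} :=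
  gm (x₁ * y₁) + gm (x₂ * y₂) - gm (x₁ * y₂) - gm (x₂ * y₁)

theorem mulDiff_comm (x₁ x₂ y₁ y₂ : PGame.{u}) :
    mulDiff x₁ x₂ y₁ y₂ = mulDiff y₁ y₂ x₁ x₂ := by
  simp only [mulDiff, gm_mul_comm x₁, gm_mul_comm x₂]
  abel

theorem mulDiff_add (x₁ x₂ x₃ y₁ y₂ : PGame.{u}) :
    mulDiff x₁ x₂ y₁ y₂ + mulDiff x₂ x₃ y₁ y₂ = mulDiff x₁ x₃ y₁ y₂ := by
  simp only [mulDiff]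
  abel

/-- Multiplication by `y` respects `x₁ ≈ x₂`, and `(x₂ - x₁) * (y - b)` has the expected sign for
`x₁ < x₂` and every option `b` of `y`. -/
def MulMono (x₁ x₂ y : PGame.{u}) : Prop :=
  (x₁ ≈ x₂ → gm (x₁ * y) = gm (x₂ * y)) ∧
  (x₁ < x₂ → (∀ b ∈ y.opt true, 0 < mulDiff x₁ x₂ b y) ∧
    ∀ b ∈ y.opt false, 0 < mulDiff x₁ x₂ y b)

theorem lt_or_equiv_or_gt {x y : PGame.{u}} (hx : x.IsSurreal) (hy : y.IsSurreal) :
    x < y ∨ x ≈ y ∨ y < x := by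
  by_cases h : x ≤ y
  · by_cases h' : y ≤ x
    · exact .inr (.inl ⟨h, h'⟩)
    · exact .inl ⟨h, h'⟩
  · exact .inr (.inr ⟨hy.le_of_not_le hx h, h⟩)

/-- The mutual comparisons needed to see that `x * y` is a surreal number. -/
def MulMonoOpts (x y : PGame.{u}) : Prop :=
  ∀ a a', IsOption a x → IsOption a' x → MulMono a a' y ∧ ∀ b, IsOption b y → MulMono a a' b

/-- The difference of the two options is `(a' - a)(y - b) + (x - a')(b' - b)`, and also `(a' - a)(y
- b') + (x - a)(b' - b)`. The second summand is positive in either form. The order of `a` and `a'`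
decides which form makes the first summand positive; if `a ≈ a'`, it vanishes. -/
theorem mul_opt_lt_of_mem_same {x y : PGame.{u}} (hx : x.IsSurreal) (hy : y.IsSurreal)
    (hxy : MulMonoOpts x y) (hyx : MulMonoOpts y x) {p : Bool} {a a' b b' : PGame.{u}}
    (ha : a ∈ x.opt p) (ha' : a' ∈ x.opt p) (hb : b ∈ y.opt p) (hb' : b' ∈ y.opt !p) :
    gm (a * y + x * b - a * b) < gm (a' * y + x * b' - a' * b') := by
  have e₁ : gm (a' * y + x * b' - a' * b') - gm (a * y + x * b - a * b) =
      mulDiff a a' b y + mulDiff a' x b b' := by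
    simp only [gm_mul_opt, mulDiff]; abel
  have e₂ : gm (a' * y + x * b' - a' * b') - gm (a * y + x * b - a * b) =
      mulDiff a a' b' y + mulDiff a x b b' := by
    simp only [gm_mul_opt, mulDiff]; abel
  have e₃ : ∀ x₁ x₂ y₁ y₂ : PGame.{u}, mulDiff x₁ x₂ y₁ y₂ = mulDiff x₂ x₁ y₂ y₁ := by
    intros; simp only [mulDiff]; abel
  rw [← sub_pos]
  have o := hxy a a' ⟨p, ha⟩ ⟨p, ha'⟩
  have o' := hxy a' a ⟨p, ha'⟩ ⟨p, ha⟩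
  have hpos : ∀ c ∈ x.opt p, 0 < mulDiff c x b b' := by
    intro c hc
    rw [mulDiff_comm]
    cases p
    · have h := hyx b' b ⟨_, hb'⟩ ⟨_, hb⟩
      rw [e₃]
      exact (h.1.2 ((hy.left_lt hb').trans (hy.lt_right hb))).2 c hc
    · have h := hyx b b' ⟨_, hb⟩ ⟨_, hb'⟩
      exact (h.1.2 ((hy.left_lt hb).trans (hy.lt_right hb'))).1 c hc
  rcases lt_or_equiv_or_gt (hx.opt ha) (hx.opt ha') with h | h | h
  · cases p
    · rw [e₂]; exact add_pos ((o.1.2 h).1 b' hb') (hpos a ha)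
    · rw [e₁]; exact add_pos ((o.1.2 h).1 b hb) (hpos a' ha')
  · have : mulDiff a a' b y = 0 := by
      rw [mulDiff, o.1.1 h, (o.2 b ⟨_, hb⟩).1 h]; abel
    rw [e₁, this, zero_add]
    exact hpos a' ha'
  · cases p
    · rw [e₁, e₃]; exact add_pos ((o'.1.2 h).2 b hb) (hpos a' ha')
    · rw [e₂, e₃]; exact add_pos ((o'.1.2 h).2 b' hb') (hpos a ha)

theorem isSurreal_mul_of_opt {x y : PGame.{u}} (hx : x.IsSurreal) (hy : y.IsSurreal)
    (hxy : MulMonoOpts x y) (hyx : MulMonoOpts y x)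
    (h₁ : ∀ a, IsOption a x → (a * y).IsSurreal) (h₂ : ∀ b, IsOption b y → (x * b).IsSurreal)
    (h₃ : ∀ a b, IsOption a x → IsOption b y → (a * b).IsSurreal) : (x * y).IsSurreal := by
  refine isSurreal_of_opt (fun v hv w hw => ?_) (fun s v hv => ?_)
  · obtain ⟨p, a, ha, b, hb, rfl⟩ := mem_opt_mul.1 hv
    obtain ⟨q, a', ha', b', hb', rfl⟩ := mem_opt_mul.1 hw
    rw [← gm_lt_iff]
    have hb : b ∈ y.opt p := by cases p <;> exact hb
    have hb' : b' ∈ y.opt !q := by cases q <;> exact hb'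
    by_cases hpq : p = q
    · subst hpq
      exact mul_opt_lt_of_mem_same hx hy hxy hyx ha ha' hb hb'
    -- Now `b` and `b'` lie on the same side of `y` while `a` and `a'` lie on opposite sides of `x`,
    -- so exchanging the factors returns to the previous case.
    · obtain rfl : q = !p := by cases p <;> cases q <;> simp_all
      have := mul_opt_lt_of_mem_same hy hx hyx hxy hb (by simpa using hb') ha ha'
      simp only [gm_mul_opt, gm_mul_comm y, gm_mul_comm b, gm_mul_comm b'] at this ⊢
      rwa [add_comm (gm (a * y)), add_comm (gm (a' * y))]
  · obtain ⟨p, a, ha, b, hb, rfl⟩ := mem_opt_mul.1 hv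
    exact ((h₁ a ⟨_, ha⟩).add (h₂ b ⟨_, hb⟩)).sub (h₃ a b ⟨_, ha⟩ ⟨_, hb⟩)

theorem equiv_lt {x y z : PGame.{u}} (h : x ≈ y) (h' : y < z) : x < z := lt_of_le_of_lt h.1 h'

theorem lt_equiv {x y z : PGame.{u}} (h : x < y) (h' : y ≈ z) : x < z := lt_of_lt_of_le h h'.1

/-- The four instances of `MulMono` in which an option replaces one of `x₁`, `x₂`. -/
def MulMonoNear (x₁ x₂ y : PGame.{u}) : Prop :=
  (∀ a, IsOption a x₁ → MulMono a x₂ y ∧ MulMono x₂ a y) ∧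
  (∀ a, IsOption a x₂ → MulMono a x₁ y ∧ MulMono x₁ a y)

theorem MulMonoNear.symm {x₁ x₂ y : PGame.{u}} (h : MulMonoNear x₁ x₂ y) : MulMonoNear x₂ x₁ y :=
  ⟨h.2, h.1⟩

/-- Since `x₁ * b` and `x₂ * b` have the same class, the gap between `x₂ * y` and a left option of
`x₁ * y` becomes `(x₂ - a)(y - b)`, whose factors have equal signs because `x₁ ≈ x₂`. Right options
of `x₂ * y` are treated in the same way. -/
theorem mul_le_mul_of_equiv {x₁ x₂ y : PGame.{u}} (hx₁ : x₁.IsSurreal) (hx₂ : x₂.IsSurreal)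
    (h : MulMonoNear x₁ x₂ y) (hb : ∀ b, IsOption b y → MulMono x₁ x₂ b) (e : x₁ ≈ x₂) :
    x₁ * y ≤ x₂ * y := by
  refine le_iff_opt.2 ⟨fun w hw => ?_, fun w hw => ?_⟩
  · obtain ⟨p, a, ha, b, hb', rfl⟩ := mem_opt_mul.1 hw
    have hb' : b ∈ y.opt p := by cases p <;> exact hb'
    refine not_le_of_gt ?_
    rw [← gm_lt_iff, ← sub_pos, gm_mul_opt, (hb b ⟨_, hb'⟩).1 e]
    cases p
    · convert ((h.1 a ⟨_, ha⟩).2.2 (equiv_lt (equiv_symm e) (hx₁.lt_right ha))).2 b hb' using 1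
      simp only [mulDiff]; abel
    · convert ((h.1 a ⟨_, ha⟩).1.2 (lt_equiv (hx₁.left_lt ha) e)).1 b hb' using 1
      simp only [mulDiff]; abel
  · obtain ⟨p, a, ha, b, hb', rfl⟩ := mem_opt_mul.1 hw
    have hb' : b ∈ y.opt !p := by cases p <;> exact hb'
    refine not_le_of_gt ?_
    rw [← gm_lt_iff, ← sub_pos, gm_mul_opt, ← (hb b ⟨_, hb'⟩).1 e]
    cases p
    · convert ((h.2 a ⟨_, ha⟩).2.2 (equiv_lt e (hx₂.lt_right ha))).1 b hb' using 1
      simp only [mulDiff]; abel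
    · convert ((h.2 a ⟨_, ha⟩).1.2 (lt_equiv (hx₂.left_lt ha) (equiv_symm e))).2 b hb' using 1
      simp only [mulDiff]

theorem mulDiff_pos_of_isSurreal_mul {x y a b : PGame.{u}} (h : (x * y).IsSurreal) {p q : Bool}
    (ha : a ∈ x.opt p) (hb : b ∈ y.opt q) :
    0 < if p = q then mulDiff a x b y else mulDiff a x y b := by
  by_cases hpq : p = q
  · subst hpq
    have := h.left_lt (mem_opt_mul.2 ⟨p, a, ha, b, by cases p <;> exact hb, rfl⟩)
    rw [← gm_lt_iff, ← sub_pos, gm_mul_opt] at this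
    rw [if_pos rfl, mulDiff]
    convert this using 1
    abel
  · have := h.lt_right (mem_opt_mul.2 ⟨p, a, ha, b, by cases p <;> cases q <;> simp_all, rfl⟩)
    rw [← gm_lt_iff, ← sub_pos, gm_mul_opt] at this
    rw [if_neg hpq, mulDiff]
    convert this using 1

/-- If `x₁ < x₂`, then a left option `c` of `x₂` or a right option `c` of `x₁` satisfies `x₁ ≤ c ≤
x₂`, and the difference product splits at `c`. The part between `c` and the number it is an option
of is positive, as that number times `y` is surreal and so separates its options. The other part is
positive by the hypotheses on options, or zero if its ends are equivalent. -/
theorem mulMono_of_opt {x₁ x₂ y : PGame.{u}} (hx₁ : x₁.IsSurreal) (hx₂ : x₂.IsSurreal)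
    (h : MulMonoNear x₁ x₂ y) (hb : ∀ b, IsOption b y → MulMonoNear x₁ x₂ b ∧
      MulMono x₁ x₂ b ∧ MulMono x₂ x₁ b)
    (h₁ : (x₁ * y).IsSurreal) (h₂ : (x₂ * y).IsSurreal) : MulMono x₁ x₂ y := by
  refine ⟨fun e => gm_eq_iff.2
    ⟨mul_le_mul_of_equiv hx₁ hx₂ h (fun b hb' => (hb b hb').2.1) e,
      mul_le_mul_of_equiv hx₂ hx₁ h.symm (fun b hb' => (hb b hb').2.2) (equiv_symm e)⟩,
    fun hlt => ?_⟩
  obtain ⟨c, hc, hle⟩ | ⟨c, hc, hle⟩ := not_le_iff_opt.1 hlt.2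
  · have hP := fun q b hb => mulDiff_pos_of_isSurreal_mul h₂ (b := b) (q := q) hc hb
    obtain hlt' | ⟨hle', e⟩ : x₁ < c ∨ x₁ ≈ c := by
      by_cases h' : c ≤ x₁
      exacts [.inr ⟨hle, h'⟩, .inl ⟨hle, h'⟩]
    · have H := (h.2 c ⟨_, hc⟩).2.2 hlt'
      refine ⟨fun b hb => ?_, fun b hb => ?_⟩ <;> rw [← mulDiff_add x₁ c x₂]
      · exact add_pos (H.1 b hb) (hP _ b hb)
      · exact add_pos (H.2 b hb) (hP _ b hb)
    · have e : x₁ ≈ c := ⟨hle', e⟩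
      have H := fun b hb' => (((hb b hb').1.2 c ⟨_, hc⟩).2.1 e)
      have H' := (h.2 c ⟨_, hc⟩).2.1 e
      refine ⟨fun b hb => ?_, fun b hb => ?_⟩
      · rw [mulDiff, H b ⟨_, hb⟩, H']; exact hP _ b hb
      · rw [mulDiff, H b ⟨_, hb⟩, H']; exact hP _ b hb
  · have e₃ : ∀ x₁ x₂ y₁ y₂ : PGame.{u}, mulDiff x₁ x₂ y₁ y₂ = mulDiff x₂ x₁ y₂ y₁ := by
      intros; simp only [mulDiff]; abel
    have hP := fun q b hb => mulDiff_pos_of_isSurreal_mul h₁ (b := b) (q := q) hc hb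
    obtain hlt' | ⟨hle', e⟩ : c < x₂ ∨ c ≈ x₂ := by
      by_cases h' : x₂ ≤ c
      exacts [.inr ⟨hle, h'⟩, .inl ⟨hle, h'⟩]
    · have H := (h.1 c ⟨_, hc⟩).1.2 hlt'
      refine ⟨fun b hb => ?_, fun b hb => ?_⟩ <;> rw [← mulDiff_add x₁ c x₂]
      · exact add_pos (by rw [e₃]; exact hP _ b hb) (H.1 b hb)
      · exact add_pos (by rw [e₃]; exact hP _ b hb) (H.2 b hb)
    · have e : c ≈ x₂ := ⟨hle', e⟩
      have H := fun b hb' => (((hb b hb').1.1 c ⟨_, hc⟩).1.1 e)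
      have H' := (h.1 c ⟨_, hc⟩).1.1 e
      refine ⟨fun b hb => ?_, fun b hb => ?_⟩
      · rw [mulDiff, ← H b ⟨_, hb⟩, ← H']
        have := hP _ b hb
        rw [if_neg (by simp), e₃] at this
        exact this
      · rw [mulDiff, ← H b ⟨_, hb⟩, ← H']
        have := hP _ b hb
        rw [if_pos rfl, e₃] at this
        exact this

theorem dm_lt_replace {α : Type*} [Preorder α] {a x : α} (h : a < x) (S : Multiset α) :
    Multiset.IsDershowitzMannaLT (S + {a}) (S + {x}) :=
  ⟨S, {a}, {x}, by simp, rfl, rfl, by simpa using h⟩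

theorem dm_lt_replace_two {α : Type*} [Preorder α] {a b x : α} (h : a < x) (h' : b < x)
    (S : Multiset α) : Multiset.IsDershowitzMannaLT (S + ({a} + {b})) (S + {x}) :=
  ⟨S, {a} + {b}, {x}, by simp, rfl, rfl, by
    simpa using ⟨h, h'⟩⟩

theorem dm_lt_drop {α : Type*} [Preorder α] (x : α) (S : Multiset α) :
    Multiset.IsDershowitzMannaLT S (S + {x}) :=
  ⟨S, 0, {x}, by simp, by simp, rfl, by simp⟩

/-- The two claims feed each other, with different numbers of arguments, so the measure is the
multiset of birthdays in the Dershowitz–Manna order. Surreality of `x * y` calls monotonicity at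
`(a, a', y)`, where one birthday is replaced by two smaller ones; monotonicity at `(x₁, x₂, y)`
calls surreality of `x₁ * y` and `x₂ * y`, where one birthday is dropped. -/
theorem isSurreal_mul_and_mulMono (m : Multiset Ordinal.{u}) :
    (∀ x y : PGame.{u}, x.IsSurreal → y.IsSurreal → m = {x.birthday} + {y.birthday} →
      (x * y).IsSurreal) ∧
    (∀ x₁ x₂ y : PGame.{u}, x₁.IsSurreal → x₂.IsSurreal → y.IsSurreal →
      m = {x₁.birthday} + {x₂.birthday} + {y.birthday} → MulMono x₁ x₂ y) := by
  have wf := Multiset.wellFounded_isDershowitzMannaLT (α := Ordinal.{u})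
  induction m using wf.induction with
  | _ m ih =>
  refine ⟨fun x y hx hy hm => ?_, fun x₁ x₂ y hx₁ hx₂ hy hm => ?_⟩
  · have opts : ∀ x y : PGame.{u}, x.IsSurreal → y.IsSurreal →
        m = {x.birthday} + {y.birthday} → MulMonoOpts x y := by
      intro x y hx hy hm a a' ha ha'
      have h := dm_lt_replace_two ha.birthday_lt ha'.birthday_lt {y.birthday}
      rw [add_comm ({y.birthday} : Multiset _) {x.birthday}, ← hm, add_comm] at h
      refine ⟨(ih _ h).2 _ _ _ (ha.isSurreal hx) (ha'.isSurreal hx) hy rfl, fun b hb => ?_⟩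
      exact (ih _ (.trans (dm_lt_replace hb.birthday_lt _) h)).2 _ _ _ (ha.isSurreal hx)
        (ha'.isSurreal hx) (hb.isSurreal hy) rfl
    have h₁ : ∀ a, IsOption a x → Multiset.IsDershowitzMannaLT ({a.birthday} + {y.birthday}) m := by
      intro a ha
      rw [hm, add_comm, add_comm ({x.birthday} : Multiset _)]
      exact dm_lt_replace ha.birthday_lt _
    refine isSurreal_mul_of_opt hx hy (opts x y hx hy hm) (opts y x hy hx (by rw [hm, add_comm]))
      (fun a ha => (ih _ (h₁ a ha)).1 a y (ha.isSurreal hx) hy rfl)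
      (fun b hb => (ih _ ?_).1 x b hx (hb.isSurreal hy) rfl)
      (fun a b ha hb => (ih _ (.trans (dm_lt_replace hb.birthday_lt _) (h₁ a ha))).1 a b
        (ha.isSurreal hx) (hb.isSurreal hy) rfl)
    rw [hm]
    exact dm_lt_replace hb.birthday_lt _
  · have key : ∀ x₁ x₂ : PGame.{u}, x₁.IsSurreal → x₂.IsSurreal →
        m = {x₁.birthday} + {x₂.birthday} + {y.birthday} →
        ∀ a, IsOption a x₁ → ∀ z : PGame.{u}, z.IsSurreal → z = y ∨ IsOption z y →
          MulMono a x₂ z ∧ MulMono x₂ a z := by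
      intro x₁ x₂ hx₁ hx₂ hm a ha z hzs hz
      have h : Multiset.IsDershowitzMannaLT ({a.birthday} + {x₂.birthday} + {z.birthday}) m := by
        have h := dm_lt_replace ha.birthday_lt ({x₂.birthday} + {y.birthday})
        rw [add_comm, add_comm _ ({x₁.birthday} : Multiset _), ← add_assoc, ← add_assoc, ← hm] at h
        obtain rfl | hz := hz
        · exact h
        · exact .trans (dm_lt_replace hz.birthday_lt _) h
      exact ⟨(ih _ h).2 _ _ _ (ha.isSurreal hx₁) hx₂ hzs rfl,
        (ih _ (by rwa [add_comm ({a.birthday} : Multiset _)] at h)).2 _ _ _ hx₂ (ha.isSurreal hx₁) hzs rfl⟩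
    have hm' : m = {x₂.birthday} + {x₁.birthday} + {y.birthday} := by
      rw [hm, add_comm ({x₁.birthday} : Multiset _)]
    have near : ∀ z : PGame.{u}, z.IsSurreal → z = y ∨ IsOption z y → MulMonoNear x₁ x₂ z :=
      fun z hzs hz => ⟨fun a ha => key x₁ x₂ hx₁ hx₂ hm a ha z hzs hz,
        fun a ha => key x₂ x₁ hx₂ hx₁ hm' a ha z hzs hz⟩
    refine mulMono_of_opt hx₁ hx₂ (near y hy (.inl rfl)) (fun b hb =>
      ⟨near b (hb.isSurreal hy) (.inr hb), (ih _ ?_).2 _ _ _ hx₁ hx₂ (hb.isSurreal hy) rfl,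
        (ih _ ?_).2 _ _ _ hx₂ hx₁ (hb.isSurreal hy) rfl⟩) ((ih _ ?_).1 _ _ hx₁ hy rfl)
      ((ih _ ?_).1 _ _ hx₂ hy rfl)
    · rw [hm]; exact dm_lt_replace hb.birthday_lt _
    · rw [hm']; exact dm_lt_replace hb.birthday_lt _
    · rw [hm, add_right_comm]; exact dm_lt_drop _ _
    · rw [hm', add_right_comm]; exact dm_lt_drop _ _

theorem IsSurreal.mul {x y : PGame.{u}} (hx : x.IsSurreal) (hy : y.IsSurreal) :
    (x * y).IsSurreal := (isSurreal_mul_and_mulMono _).1 x y hx hy rfl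

theorem mulMono {x₁ x₂ y : PGame.{u}} (hx₁ : x₁.IsSurreal) (hx₂ : x₂.IsSurreal)
    (hy : y.IsSurreal) : MulMono x₁ x₂ y :=
  (isSurreal_mul_and_mulMono _).2 x₁ x₂ y hx₁ hx₂ hy rfl

theorem mul_equiv_mul_right {x₁ x₂ y : PGame.{u}} (hx₁ : x₁.IsSurreal) (hx₂ : x₂.IsSurreal)
    (hy : y.IsSurreal) (h : x₁ ≈ x₂) : x₁ * y ≈ x₂ * y :=
  gm_eq_iff.1 ((mulMono hx₁ hx₂ hy).1 h)

/-- A positive `y` has a left option `b ≥ 0`, and positivity of `(x - 0)(y - b)` gives `x * b < x *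
y`. As `b` may be equivalent to zero, the induction covers that case too. -/
theorem mul_pos' {x y : PGame.{u}} (hx : x.IsSurreal) (hy : y.IsSurreal) (hx0 : 0 < x)
    (hy0 : 0 < y) : 0 < x * y := by
  have main : ∀ x y : PGame.{u}, x.IsSurreal → y.IsSurreal → 0 < x → 0 ≈ y ∨ 0 < y →
      (0 : PGame.{u}) ≤ x * y ∧ (0 < y → 0 < x * y) := by
    intro x y
    induction y using opt_induction with
    | ih y ihy =>
    intro hx hy hx0 hy0
    have key : 0 < y → 0 < x * y := by
      intro h
      obtain ⟨b, hb, hle⟩ | ⟨b, hb, _⟩ := not_le_iff_opt.1 h.2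
      · have h₁ := ((mulMono isSurreal_zero hx hy).2 hx0).1 b hb
        have hb0 : 0 ≈ b ∨ 0 < b := by
          by_cases h' : b ≤ 0
          exacts [.inl ⟨hle, h'⟩, .inr ⟨hle, h'⟩]
        have h₂ := (ihy _ b hb hx (hy.opt hb) hx0 hb0).1
        rw [mulDiff, gm_zero_mul, gm_zero_mul, zero_add, sub_zero, sub_pos] at h₁
        exact lt_of_le_of_lt (gm_le_iff.2 h₂) h₁
      · exact (notMem_opt_zero _ _ hb).elim
    refine ⟨?_, key⟩
    obtain h | h := hy0
    · have := gm_eq_iff.2 (mul_equiv_mul_right isSurreal_zero hy hx h)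
      rw [gm_zero_mul, gm_mul_comm] at this
      exact (gm_eq_iff.1 this).1
    · exact (key h).1
  exact (main x y hx hy hx0 (.inr hy0)).2 hy0

/-! ### Canonical representatives -/

theorem bornEq_le {x y : PGame.{u}} (hy : y.IsSurreal) (h : y ≈ x) : bornEq x ≤ y.birthday :=
  csInf_le' ⟨y, hy, h, rfl⟩

theorem bornEqSet_nonempty {x : PGame.{u}} (hx : x.IsSurreal) : (bornEqSet x).Nonempty := by
  obtain ⟨y, hy, h, h'⟩ := csInf_mem
    (s := {α | ∃ y : PGame.{u}, y.IsSurreal ∧ y ≈ x ∧ y.birthday = α}) ⟨_, x, hx, equiv_refl x, rfl⟩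
  exact ⟨y, hy, h, h'⟩

theorem bornEq_congr {x y : PGame.{u}} (h : x ≈ y) : bornEq x = bornEq y := by
  have : ∀ z : PGame.{u}, z ≈ x ↔ z ≈ y :=
    fun z => ⟨fun h' => equiv_trans h' h, fun h' => equiv_trans h' (equiv_symm h)⟩
  simp only [bornEq, this]

theorem bornEqSet_congr {x y : PGame.{u}} (h : x ≈ y) : bornEqSet x = bornEqSet y := by
  have : ∀ z : PGame.{u}, z ≈ x ↔ z ≈ y :=
    fun z => ⟨fun h' => equiv_trans h' h, fun h' => equiv_trans h' (equiv_symm h)⟩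
  simp only [bornEqSet, this, bornEq_congr h]

theorem chooseSmallest_mem {Y : Set PGame.{u}} (hY : Y.Nonempty) : chooseSmallest Y ∈ Y := by
  obtain ⟨c, hc, hmin⟩ := (InvImage.wf optionSize.{u} Ordinal.lt_wf).has_min Y hY
  exact (Classical.epsilon_spec (p := fun c => c ∈ Y ∧ ∀ d ∈ Y, c.optionSize ≤ d.optionSize)
    ⟨c, hc, fun d hd => not_lt.1 (hmin d hd)⟩).1

/-- The youngest members of the class of `x` made of canonical representatives born before `α`. -/
def candidates (α : Ordinal.{u}) (x : PGame.{u}) : Set PGame.{u} :=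
  bornEqSet x ∩ madeOf (⋃ β : Set.Iio α, canonicalUpTo β.1)

theorem mem_canonicalUpTo {α : Ordinal.{u}} {x : PGame.{u}} : x ∈ canonicalUpTo α ↔
    (∃ β < α, x ∈ canonicalUpTo β) ∨ (x.IsSurreal ∧ α = bornEq x ∧ (candidates α x).Nonempty ∧
      x = chooseSmallest (candidates α x)) := by
  rw [canonicalUpTo]
  simp [candidates]

theorem isUSurreal_iff {x : PGame.{u}} : x.IsUSurreal ↔ x.IsSurreal ∧
    (candidates (bornEq x) x).Nonempty ∧ x = chooseSmallest (candidates (bornEq x) x) := by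
  constructor
  · rintro ⟨α, h⟩
    induction α using WellFoundedLT.induction with
    | ind α ih =>
      obtain ⟨β, hβ, h⟩ | ⟨h₁, rfl, h₂⟩ := mem_canonicalUpTo.1 h
      · exact ih β hβ h
      · exact ⟨h₁, h₂⟩
  · exact fun h => ⟨bornEq x, mem_canonicalUpTo.2 (.inr ⟨h.1, rfl, h.2⟩)⟩

theorem IsUSurreal.isSurreal {x : PGame.{u}} (h : x.IsUSurreal) : x.IsSurreal :=
  (isUSurreal_iff.1 h).1

theorem IsUSurreal.birthday_eq {x : PGame.{u}} (h : x.IsUSurreal) : x.birthday = bornEq x := by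
  obtain ⟨_, h₁, h₂⟩ := isUSurreal_iff.1 h
  have := chooseSmallest_mem h₁
  rw [← h₂] at this
  exact this.1.2.2

theorem IsUSurreal.birthday_le {x y : PGame.{u}} (h : x.IsUSurreal) (hy : y.IsSurreal)
    (e : x ≈ y) : x.birthday ≤ y.birthday :=
  h.birthday_eq.trans_le (bornEq_le hy (equiv_symm e))

theorem IsUSurreal.mem_canonicalUpTo {x : PGame.{u}} (h : x.IsUSurreal) :
    x ∈ canonicalUpTo (bornEq x) :=
  PGame.mem_canonicalUpTo.2 (.inr ⟨h.isSurreal, rfl, (isUSurreal_iff.1 h).2⟩)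

theorem IsUSurreal.eq_of_equiv {x y : PGame.{u}} (hx : x.IsUSurreal) (hy : y.IsUSurreal)
    (h : x ≈ y) : x = y := by
  rw [(isUSurreal_iff.1 hx).2.2, (isUSurreal_iff.1 hy).2.2, candidates, candidates,
    bornEq_congr h, bornEqSet_congr h]

/-- Options of a youngest member of the class have smaller least birthday, so by induction each can
be replaced by its canonical representative. The result is still equivalent to `x` and no older,
hence is a candidate, and the choice is made from a nonempty set. -/
theorem exists_isUSurreal {x : PGame.{u}} (hx : x.IsSurreal) : ∃ y : PGame.{u}, y.IsUSurreal ∧ y ≈ x := by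
  induction h : bornEq x using WellFoundedLT.induction generalizing x with
  | ind α ih =>
  obtain ⟨y, hy, hyx, hb⟩ := bornEqSet_nonempty hx
  have hopt : ∀ a, IsOption a y → ∃ b : PGame.{u}, b.IsUSurreal ∧ b ≈ a ∧ bornEq b < α := by
    intro a ha
    have hlt : bornEq a < α := by
      rw [← h, ← hb]
      exact (bornEq_le (ha.isSurreal hy) (equiv_refl a)).trans_lt ha.birthday_lt
    obtain ⟨b, hb, hba⟩ := ih _ hlt (ha.isSurreal hy) rfl
    exact ⟨b, hb, hba, by rwa [bornEq_congr hba]⟩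
  obtain ⟨z, hz, hzc⟩ : ∃ z : PGame.{u}, z ≈ y ∧
      ∀ s, ∀ a ∈ z.opt s, a.IsUSurreal ∧ bornEq a < α := by
    cases y with
    | mk ι κ L R =>
      choose fL hL using fun i => hopt (L i) ⟨true, i, rfl⟩
      choose fR hR using fun i => hopt (R i) ⟨false, i, rfl⟩
      refine ⟨mk ι κ fL fR, equiv_of_opt ?_ ?_, ?_⟩ <;> rintro (_ | _) _ ⟨i, rfl⟩
      · exact ⟨_, ⟨i, rfl⟩, (hR i).2.1⟩
      · exact ⟨_, ⟨i, rfl⟩, (hL i).2.1⟩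
      · exact ⟨_, ⟨i, rfl⟩, equiv_symm (hR i).2.1⟩
      · exact ⟨_, ⟨i, rfl⟩, equiv_symm (hL i).2.1⟩
      · exact ⟨(hR i).1, (hR i).2.2⟩
      · exact ⟨(hL i).1, (hL i).2.2⟩
  -- The new left options lie below `y` and the new right options above it, because `z ≈ y`.
  have hzs : z.IsSurreal := by
    refine isSurreal_iff.2 ⟨fun a ha b hb hle => ?_, fun s a ha => (hzc s a ha).1.isSurreal⟩
    have h₁ := not_le_left ha
    have h₂ := not_right_le hb
    have h₃ : y < b := lt_of_le_of_lt hz.2 ⟨?_, h₂⟩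
    have h₄ : a < y := lt_of_lt_of_le ⟨?_, h₁⟩ hz.1
    · exact (h₃.trans_le (hle.trans h₄.le)).false
    · refine le_trans (IsSurreal.le_of_not_le (hzc _ a ha).1.isSurreal hy fun h => h₁ (hz.1.trans h)) hz.2
    · exact le_trans hz.1 (IsSurreal.le_of_not_le hy (hzc _ b hb).1.isSurreal fun h => h₂ (h.trans hz.2))
  have hzx := equiv_trans hz hyx
  have hzb : z.birthday = bornEq x := by
    refine le_antisymm ?_ (bornEq_le hzs hzx)
    rw [h]
    exact birthday_le_iff.2 fun s a ha => (hzc s a ha).1.birthday_eq.trans_lt (hzc s a ha).2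
  have hne : (candidates (bornEq x) x).Nonempty := by
    refine ⟨z, ⟨hzs, hzx, hzb⟩, ?_⟩
    have : ∀ s, ∀ a ∈ z.opt s, a ∈ ⋃ β : Set.Iio (bornEq x), canonicalUpTo β.1 := fun s a ha =>
      Set.mem_iUnion.2 ⟨⟨bornEq a, h ▸ (hzc s a ha).2⟩, (hzc s a ha).1.mem_canonicalUpTo⟩
    exact ⟨forall_opt_true.1 (this true), forall_opt_false.1 (this false)⟩
  have hc := chooseSmallest_mem hne
  refine ⟨_, isUSurreal_iff.2 ⟨hc.1.1, ?_⟩, hc.1.2.1⟩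
  have e := hc.1.2.1
  have : candidates (bornEq (chooseSmallest (candidates (bornEq x) x)))
      (chooseSmallest (candidates (bornEq x) x)) = candidates (bornEq x) x := by
    rw [bornEq_congr e, candidates, bornEqSet_congr e, ← candidates]
  rw [this]
  exact ⟨hne, rfl⟩

theorem uniq_spec {x : PGame.{u}} (hx : x.IsSurreal) : (uniq x).IsUSurreal ∧ uniq x ≈ x :=
  Classical.epsilon_spec (exists_isUSurreal hx)

/-! ### The ordered ring of surreal numbers -/

/-- Equivalence of surreal numbers, as a setoid. -/
def surrealSetoid : Setoid {x : PGame.{u} // x.IsSurreal} :=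
  ⟨fun x y => x.1 ≈ y.1, fun _ => equiv_refl _, equiv_symm, equiv_trans⟩

/-- Surreal numbers modulo equivalence. -/
def Surreal : Type (u + 1) := Quotient surrealSetoid.{u}

namespace Surreal

/-- The class of the surreal number `x`. -/
def of (x : PGame.{u}) (hx : x.IsSurreal) : Surreal.{u} := Quotient.mk surrealSetoid ⟨x, hx⟩

theorem ind {P : Surreal.{u} → Prop} (h : ∀ x hx, P (of x hx)) (a : Surreal.{u}) : P a :=
  Quotient.ind (fun x => h x.1 x.2) a

theorem of_eq_of {x y : PGame.{u}} {hx : x.IsSurreal} {hy : y.IsSurreal} :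
    of x hx = of y hy ↔ gm x = gm y :=
  ⟨fun h => gm_eq_iff.2 (Quotient.exact (s := surrealSetoid) h),
    fun h => Quotient.sound (s := surrealSetoid) (gm_eq_iff.1 h)⟩

instance : LE Surreal.{u} := ⟨Quotient.lift₂ (fun x y => x.1 ≤ y.1) fun _ _ _ _ h h' =>
  propext ⟨fun H => (h.2.trans H).trans h'.1, fun H => (h.1.trans H).trans h'.2⟩⟩

instance : Zero Surreal.{u} := ⟨of 0 isSurreal_zero⟩

instance : One Surreal.{u} := ⟨of 1 isSurreal_one⟩

instance : Neg Surreal.{u} := ⟨Quotient.map (fun x => ⟨-x.1, x.2.neg⟩) fun _ _ h =>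
  gm_eq_iff.1 (by rw [gm_neg, gm_neg, gm_eq_iff.2 h])⟩

instance : Add Surreal.{u} := ⟨Quotient.map₂ (fun x y => ⟨x.1 + y.1, x.2.add y.2⟩)
  fun _ _ h _ _ h' => gm_eq_iff.1 (by rw [gm_add, gm_add, gm_eq_iff.2 h, gm_eq_iff.2 h'])⟩

instance : Mul Surreal.{u} := ⟨Quotient.map₂ (fun x y => ⟨x.1 * y.1, x.2.mul y.2⟩)
  fun a b h c d h' => gm_eq_iff.1 (by
    rw [gm_eq_iff.2 (mul_equiv_mul_right a.2 b.2 c.2 h), gm_mul_comm, gm_mul_comm b.1,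
      gm_eq_iff.2 (mul_equiv_mul_right c.2 d.2 b.2 h')])⟩

instance : CommRing Surreal.{u} where
  add_assoc := ind fun _ _ => ind fun _ _ => ind fun _ _ => of_eq_of.2 (by
    simp only [gm_add, add_assoc])
  add_comm := ind fun _ _ => ind fun _ _ => of_eq_of.2 (by rw [gm_add, gm_add, add_comm])
  zero_add := ind fun _ _ => of_eq_of.2 (by rw [gm_add, gm_zero, zero_add])
  add_zero := ind fun _ _ => of_eq_of.2 (by rw [gm_add, gm_zero, add_zero])
  neg_add_cancel := ind fun _ _ => of_eq_of.2 (by rw [gm_add, gm_neg, neg_add_cancel, gm_zero])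
  mul_assoc := ind fun _ _ => ind fun _ _ => ind fun _ _ => of_eq_of.2 (gm_mul_assoc _ _ _)
  mul_comm := ind fun _ _ => ind fun _ _ => of_eq_of.2 (gm_mul_comm _ _)
  one_mul := ind fun _ _ => of_eq_of.2 (by rw [gm_mul_comm, gm_mul_one])
  mul_one := ind fun _ _ => of_eq_of.2 (gm_mul_one _)
  zero_mul := ind fun _ _ => of_eq_of.2 (gm_zero_mul _)
  mul_zero := ind fun _ _ => of_eq_of.2 (gm_mul_zero _)
  left_distrib := ind fun _ _ => ind fun _ _ => ind fun _ _ => of_eq_of.2 (by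
    rw [gm_mul_add, gm_add])
  right_distrib := ind fun _ _ => ind fun _ _ => ind fun _ _ => of_eq_of.2 (by
    rw [gm_add_mul, gm_add])
  nsmul := nsmulRec
  zsmul := zsmulRec

open Classical in
instance : LinearOrder Surreal.{u} where
  le_refl := ind fun x _ => le_refl x
  le_trans := ind fun _ _ => ind fun _ _ => ind fun _ _ => PGame.le_trans
  le_antisymm := ind fun _ _ => ind fun _ _ => fun h h' => of_eq_of.2 (gm_eq_iff.2 ⟨h, h'⟩)
  le_total := ind fun x hx => ind fun y hy =>
    (Classical.em (x ≤ y)).imp id fun h => hy.le_of_not_le hx h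
  toDecidableLE := Classical.decRel _

instance : Nontrivial Surreal.{u} :=
  ⟨0, 1, fun h => not_le_left zero_mem_opt_one (gm_eq_iff.1 (of_eq_of.1 h)).2⟩

instance : IsOrderedAddMonoid Surreal.{u} where
  add_le_add_left := ind fun _ _ => ind fun _ _ h => ind fun _ _ => add_le_add_iff_right'.2 h

instance : ZeroLEOneClass Surreal.{u} := ⟨(isSurreal_one.left_lt zero_mem_opt_one).1⟩

instance : IsStrictOrderedRing Surreal.{u} :=
  .of_mul_pos (ind fun _ hx => ind fun _ hy => mul_pos' hx hy)

end Surreal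

open Classical in
/-- The class of `x`, which is `0` if `x` is not a surreal number. -/
def val (x : PGame.{u}) : Surreal.{u} := if h : x.IsSurreal then .of x h else 0

theorem val_of {x : PGame.{u}} (hx : x.IsSurreal) : val x = .of x hx := dif_pos hx

theorem val_le_val {x y : PGame.{u}} (hx : x.IsSurreal) (hy : y.IsSurreal) :
    val x ≤ val y ↔ x ≤ y := by rw [val_of hx, val_of hy]; rfl

theorem val_lt_val {x y : PGame.{u}} (hx : x.IsSurreal) (hy : y.IsSurreal) :
    val x < val y ↔ x < y := by
  rw [lt_iff_le_not_ge, val_le_val hx hy, val_le_val hy hx]; rfl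

theorem val_eq_val {x y : PGame.{u}} (hx : x.IsSurreal) (hy : y.IsSurreal) :
    val x = val y ↔ x ≈ y := by
  rw [le_antisymm_iff, val_le_val hx hy, val_le_val hy hx]

theorem val_zero : val (0 : PGame.{u}) = 0 := val_of isSurreal_zero

theorem val_one : val (1 : PGame.{u}) = 1 := val_of isSurreal_one

theorem val_neg {x : PGame.{u}} (hx : x.IsSurreal) : val (-x) = -val x := by
  rw [val_of hx, val_of hx.neg]; rfl

theorem val_add {x y : PGame.{u}} (hx : x.IsSurreal) (hy : y.IsSurreal) :
    val (x + y) = val x + val y := by rw [val_of hx, val_of hy, val_of (hx.add hy)]; rfl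

theorem val_sub {x y : PGame.{u}} (hx : x.IsSurreal) (hy : y.IsSurreal) :
    val (x - y) = val x - val y := by
  rw [sub_eq_add_neg, ← val_neg hy, ← val_add hx hy.neg]; rfl

theorem val_mul {x y : PGame.{u}} (hx : x.IsSurreal) (hy : y.IsSurreal) :
    val (x * y) = val x * val y := by rw [val_of hx, val_of hy, val_of (hx.mul hy)]; rfl

theorem exists_val_eq (a : Surreal.{u}) : ∃ x : PGame.{u}, x.IsSurreal ∧ val x = a := by
  induction a using Surreal.ind with
  | h x hx => exact ⟨x, hx, val_of hx⟩

theorem isSurreal_absVal {x : PGame.{u}} (hx : x.IsSurreal) : (absVal x).IsSurreal := by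
  unfold absVal
  split_ifs
  exacts [hx, hx.neg]

theorem val_absVal {x : PGame.{u}} (hx : x.IsSurreal) : val (absVal x) = |val x| := by
  unfold absVal
  split_ifs with h <;> rw [← val_le_val isSurreal_zero hx, val_zero] at h
  · rw [abs_of_nonneg h]
  · rw [abs_of_neg (not_le.1 h), val_neg hx]

/-! ### Integers and dyadic numbers -/

theorem gm_ofNat_succ (n : ℕ) : gm (ofNat.{u} (n + 1)) = gm (ofNat.{u} n + 1) := by
  induction n with
  | zero =>
    refine gm_eq_of_opt (fun s a ha => ?_) (fun s a ha => ?_)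
    · exact ⟨0 + 0, mem_opt_add.2 (.inr ⟨a, ha, by rw [(eq_of_mem_opt_one ha).2]; rfl⟩),
        by rw [(eq_of_mem_opt_one ha).2, gm_add, gm_zero, zero_add]⟩
    · obtain ⟨b, hb, rfl⟩ | ⟨b, hb, rfl⟩ := mem_opt_add.1 ha
      · exact (notMem_opt_zero _ _ hb).elim
      · exact ⟨b, hb, (gm_add _ _).trans (zero_add _)⟩
  | succ n ih =>
    refine gm_eq_of_opt (fun s a ha => ?_) (fun s a ha => ?_)
    · cases s
      · obtain ⟨⟨⟩, _⟩ := ha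
      · obtain ⟨_, rfl⟩ := ha
        exact ⟨_, mem_opt_add.2 (.inr ⟨0, zero_mem_opt_one, rfl⟩),
          ((gm_add _ _).trans (add_zero _)).symm⟩
    · obtain ⟨b, hb, rfl⟩ | ⟨b, hb, rfl⟩ := mem_opt_add.1 ha
      · cases s
        · obtain ⟨⟨⟩, _⟩ := hb
        · obtain ⟨_, rfl⟩ := hb
          exact ⟨_, ⟨PUnit.unit, rfl⟩, ih.symm⟩
      · obtain ⟨rfl, rfl⟩ := eq_of_mem_opt_one hb
        exact ⟨_, ⟨PUnit.unit, rfl⟩, (gm_add _ _).trans (add_zero _)⟩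

theorem isSurreal_ofNat (n : ℕ) : (ofNat.{u} n).IsSurreal := by
  induction n with
  | zero => exact isSurreal_zero
  | succ n ih => exact ⟨fun _ => PEmpty.rec, fun _ => ih, PEmpty.rec⟩

theorem val_ofNat (n : ℕ) : val (ofNat.{u} n) = n := by
  induction n with
  | zero => exact val_zero.trans Nat.cast_zero.symm
  | succ n ih =>
    rw [Nat.cast_succ, ← ih, ← val_one, ← val_add (isSurreal_ofNat n) isSurreal_one,
      val_eq_val (isSurreal_ofNat _) ((isSurreal_ofNat n).add isSurreal_one), ← gm_eq_iff,
      gm_ofNat_succ]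

theorem ofNegNat_eq (n : ℕ) : ofNegNat.{u} n = -ofNat n := by
  induction n with
  | zero =>
    show mk _ _ _ _ = mk _ _ _ _
    congr 1 <;> exact funext fun i => i.elim
  | succ n ih =>
    show mk _ _ _ _ = mk _ _ _ _
    congr 1
    · exact funext fun i => i.elim
    · exact funext fun _ => ih

theorem isSurreal_ofInt (j : ℤ) : (ofInt.{u} j).IsSurreal := by
  cases j with
  | ofNat n => exact isSurreal_ofNat n
  | negSucc n =>
    show (ofNegNat (n + 1)).IsSurreal
    rw [ofNegNat_eq]
    exact (isSurreal_ofNat _).neg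

theorem val_ofInt (j : ℤ) : val (ofInt.{u} j) = j := by
  cases j with
  | ofNat n => exact (val_ofNat n).trans (Int.cast_natCast n).symm
  | negSucc n =>
    show val (ofNegNat (n + 1)) = _
    rw [ofNegNat_eq, val_neg (isSurreal_ofNat _), val_ofNat, Int.cast_negSucc]

theorem ofInt_opt_left {j : ℤ} {c : PGame.{u}} (hc : c ∈ (ofInt j).opt true) :
    c = ofInt (j - 1) := by
  rcases j with (_ | n) | n
  · exact (notMem_opt_zero true c hc).elim
  · obtain ⟨_, rfl⟩ := hc
    have : Int.ofNat (n + 1) - 1 = Int.ofNat n := by simp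
    rw [this]; rfl
  · obtain ⟨⟨⟩, _⟩ := hc

theorem ofInt_opt_right {j : ℤ} {c : PGame.{u}} (hc : c ∈ (ofInt j).opt false) :
    c = ofInt (j + 1) := by
  rcases j with (_ | n) | (_ | n)
  · exact (notMem_opt_zero false c hc).elim
  · obtain ⟨⟨⟩, _⟩ := hc
  · obtain ⟨_, rfl⟩ := hc
    rfl
  · obtain ⟨_, rfl⟩ := hc
    rfl

/-- If `z = {a | b}` and the options of `a` and of `b` are not too close to them, then `z` is the
mean of `a` and `b`. -/
theorem val_add_val_of_opt {a b z : PGame.{u}} (hz : z.IsSurreal) (hL : ∀ c, c ∈ z.opt true ↔ c = a)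
    (hR : ∀ c, c ∈ z.opt false ↔ c = b)
    (h₁ : ∀ c ∈ a.opt false, val b ≤ val c) (h₂ : ∀ c ∈ b.opt false, val b + val b ≤ val a + val c)
    (h₃ : ∀ c ∈ b.opt true, val c ≤ val a) (h₄ : ∀ c ∈ a.opt true, val c + val b ≤ val a + val a) :
    val z + val z = val a + val b := by
  have ha := hz.opt ((hL a).2 rfl)
  have hb := hz.opt ((hR b).2 rfl)
  have haz := (val_lt_val ha hz).2 (hz.left_lt ((hL a).2 rfl))
  have hzb := (val_lt_val hz hb).2 (hz.lt_right ((hR b).2 rfl))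
  rw [← val_add hz hz, ← val_add ha hb, val_eq_val (hz.add hz) (ha.add hb)]
  refine ⟨le_iff_opt.2 ⟨fun w hw => ?_, fun w hw => ?_⟩,
    le_iff_opt.2 ⟨fun w hw => ?_, fun w hw => ?_⟩⟩ <;>
  obtain ⟨c, hc, rfl⟩ | ⟨c, hc, rfl⟩ := mem_opt_add.1 hw
  · rw [hL] at hc; subst hc
    rw [← val_le_val (ha.add hb) (ha.add hz), val_add ha hb, val_add ha hz]
    linarith
  · rw [hL] at hc; subst hc
    rw [← val_le_val (ha.add hb) (hz.add ha), val_add ha hb, val_add hz ha]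
    linarith
  · have := h₁ c hc
    rw [← val_le_val ((ha.opt hc).add hb) (hz.add hz), val_add (ha.opt hc) hb, val_add hz hz]
    linarith
  · have := h₂ c hc
    rw [← val_le_val (ha.add (hb.opt hc)) (hz.add hz), val_add ha (hb.opt hc), val_add hz hz]
    linarith
  · have := h₄ c hc
    rw [← val_le_val (hz.add hz) ((ha.opt hc).add hb), val_add (ha.opt hc) hb, val_add hz hz]
    linarith
  · have := h₃ c hc
    rw [← val_le_val (hz.add hz) (ha.add (hb.opt hc)), val_add ha (hb.opt hc), val_add hz hz]
    linarith
  · rw [hR] at hc; subst hc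
    rw [← val_le_val (hb.add hz) (ha.add hb), val_add ha hb, val_add hb hz]
    linarith
  · rw [hR] at hc; subst hc
    rw [← val_le_val (hz.add hb) (ha.add hb), val_add ha hb, val_add hz hb]
    linarith

/-- The option bounds are the induction invariant: no option is nearer than the neighbouring
fraction of the same level. This is what `val_add_val_of_opt` needs to identify an odd fraction of
the next level with a mean. Values are stated with denominators cleared because only a ring is
available. -/
theorem ofDyadic_spec (p : ℕ) (j : ℤ) : (ofDyadic.{u} p j).IsSurreal ∧
    2 ^ p * val (ofDyadic.{u} p j) = j ∧
    (∀ c ∈ (ofDyadic.{u} p j).opt true, val c ≤ val (ofDyadic.{u} p (j - 1))) ∧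
    ∀ c ∈ (ofDyadic.{u} p j).opt false, val (ofDyadic.{u} p (j + 1)) ≤ val c := by
  induction p generalizing j with
  | zero =>
    exact ⟨isSurreal_ofInt j, by rw [pow_zero, one_mul]; exact val_ofInt j,
      fun c hc => (congrArg val (ofInt_opt_left hc)).le,
      fun c hc => (congrArg val (ofInt_opt_right hc)).ge⟩
  | succ p ih =>
    have h2 : (0 : Surreal.{u}) < 2 ^ p := by positivity
    have key : ∀ k : ℤ, (ofDyadic.{u} (p + 1) (2 * k) = ofDyadic p k) ∧
        ofDyadic.{u} (p + 1) (2 * k + 1) =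
          mk PUnit PUnit (fun _ => ofDyadic p k) (fun _ => ofDyadic p (k + 1)) := by
      intro k
      constructor
      · rw [ofDyadic, if_pos (even_two_mul k), Int.mul_ediv_cancel_left _ two_ne_zero]
      · have : (2 * k + 1) / 2 = k := by omega
        rw [ofDyadic, if_neg (by simp), this]
    have lt_succ : ∀ k : ℤ, val (ofDyadic.{u} p k) < val (ofDyadic.{u} p (k + 1)) := by
      intro k
      rw [← mul_lt_mul_iff_right₀ h2, (ih _).2.1, (ih _).2.1]
      exact_mod_cast lt_add_one k
    have odd : ∀ k : ℤ, (ofDyadic.{u} (p + 1) (2 * k + 1)).IsSurreal ∧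
        val (ofDyadic.{u} (p + 1) (2 * k + 1)) + val (ofDyadic.{u} (p + 1) (2 * k + 1)) =
          val (ofDyadic.{u} p k) + val (ofDyadic.{u} p (k + 1)) := by
      intro k
      have hs : (ofDyadic.{u} (p + 1) (2 * k + 1)).IsSurreal := by
        rw [(key k).2]
        refine ⟨fun _ _ => ?_, fun _ => (ih _).1, fun _ => (ih _).1⟩
        exact ((val_lt_val (ih _).1 (ih _).1).1 (lt_succ k)).2
      have mean : ∀ k : ℤ, val (ofDyadic.{u} p (k - 1)) + val (ofDyadic.{u} p (k + 1)) =
          val (ofDyadic.{u} p k) + val (ofDyadic.{u} p k) := by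
        intro k
        apply mul_left_cancel₀ h2.ne'
        rw [mul_add, mul_add, (ih _).2.1, (ih _).2.1, (ih _).2.1]
        push_cast
        ring
      refine ⟨hs, val_add_val_of_opt hs (fun c => ?_) (fun c => ?_) (ih k).2.2.2 (fun c hc => ?_)
        (fun c hc => ?_) (fun c hc => ?_)⟩
      · rw [(key k).2, mem_opt_mk_true]
        exact ⟨fun ⟨_, h⟩ => h.symm, fun h => ⟨⟨⟩, h.symm⟩⟩
      · rw [(key k).2, mem_opt_mk_false]
        exact ⟨fun ⟨_, h⟩ => h.symm, fun h => ⟨⟨⟩, h.symm⟩⟩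
      · have h₁ := (ih (k + 1)).2.2.2 c hc
        have h₂ := mean (k + 1)
        rw [add_sub_cancel_right] at h₂
        linarith
      · have := (ih (k + 1)).2.2.1 c hc
        rwa [add_sub_cancel_right] at this
      · have h₁ := (ih k).2.2.1 c hc
        have h₂ := mean k
        linarith
    have near : ∀ k : ℤ, val (ofDyadic.{u} p k) < val (ofDyadic.{u} (p + 1) (2 * k + 1)) ∧
        val (ofDyadic.{u} (p + 1) (2 * k + 1)) < val (ofDyadic.{u} p (k + 1)) := by
      intro k
      have h₁ := (odd k).2
      have h₂ := lt_succ k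
      constructor <;> linarith
    obtain ⟨k, rfl | rfl⟩ := j.even_or_odd'
    · rw [(key k).1]
      refine ⟨(ih k).1, ?_, fun c hc => ?_, fun c hc => ((near k).2.le.trans ?_)⟩
      · rw [pow_succ', mul_assoc, (ih k).2.1]; push_cast; rfl
      · have h₁ := (near (k - 1)).1.le
        rw [show 2 * (k - 1) + 1 = 2 * k - 1 by ring] at h₁
        exact ((ih k).2.2.1 c hc).trans h₁
      · exact (ih k).2.2.2 c hc
    · refine ⟨(odd k).1, ?_, fun c hc => ?_, fun c hc => ?_⟩
      · rw [pow_succ, mul_assoc, two_mul, (odd k).2, mul_add, (ih _).2.1, (ih _).2.1]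
        push_cast; ring
      · rw [(key k).2] at hc
        obtain ⟨_, rfl⟩ := hc
        rw [add_sub_cancel_right, (key k).1]
        exact le_rfl
      · rw [(key k).2] at hc
        obtain ⟨_, rfl⟩ := hc
        rw [show 2 * k + 1 + 1 = 2 * (k + 1) by ring, (key _).1]
        exact le_rfl

/-! ### Real numbers -/

/-- The cut of dyadic numbers defining `ofReal r`. -/
def realCut (r : ℝ) : PGame.{u} :=
  mk (ULift.{u} ℕ) (ULift.{u} ℕ)
    (fun n => ofDyadic n.down ⌈r * 2 ^ n.down - 1⌉)
    (fun n => ofDyadic n.down ⌊r * 2 ^ n.down + 1⌋)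

theorem isSurreal_realCut (r : ℝ) : (realCut.{u} r).IsSurreal := by
  refine ⟨fun ⟨m⟩ ⟨n⟩ => not_le_of_gt ?_, fun _ => (ofDyadic_spec _ _).1,
    fun _ => (ofDyadic_spec _ _).1⟩
  rw [← val_lt_val (ofDyadic_spec _ _).1 (ofDyadic_spec _ _).1]
  have hm : (0 : Surreal.{u}) < 2 ^ m := by positivity
  have hn : (0 : Surreal.{u}) < 2 ^ n := by positivity
  have hm' : (0 : ℝ) < 2 ^ m := by positivity
  have hn' : (0 : ℝ) < 2 ^ n := by positivity
  have h₁ : (⌈r * 2 ^ m - 1⌉ : ℝ) < r * 2 ^ m := by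
    linarith [Int.ceil_lt_add_one (r * 2 ^ m - 1)]
  have h₂ : r * 2 ^ n < (⌊r * 2 ^ n + 1⌋ : ℝ) := by
    linarith [Int.lt_floor_add_one (r * 2 ^ n + 1)]
  have h₃ : (2 ^ n * ⌈r * 2 ^ m - 1⌉ : ℝ) < 2 ^ m * ⌊r * 2 ^ n + 1⌋ := by
    nlinarith
  have h₄ : (2 ^ n * ⌈r * 2 ^ m - 1⌉ : ℤ) < 2 ^ m * ⌊r * 2 ^ n + 1⌋ := by exact_mod_cast h₃
  have h₅ : (2 ^ n * ⌈r * 2 ^ m - 1⌉ : Surreal.{u}) < 2 ^ m * ⌊r * 2 ^ n + 1⌋ := by exact_mod_cast h₄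
  have e₁ := (ofDyadic_spec.{u} m ⌈r * 2 ^ m - 1⌉).2.1
  have e₂ := (ofDyadic_spec.{u} n ⌊r * 2 ^ n + 1⌋).2.1
  rw [← mul_lt_mul_iff_right₀ (mul_pos hm hn)]
  rw [← e₁, ← e₂] at h₅
  show 2 ^ m * 2 ^ n * val (ofDyadic.{u} m _) < 2 ^ m * 2 ^ n * val (ofDyadic.{u} n _)
  linarith

theorem isUSurreal_ofReal (r : ℝ) : (ofReal.{u} r).IsUSurreal :=
  (uniq_spec (isSurreal_realCut r)).1

theorem isSurreal_ofReal (r : ℝ) : (ofReal.{u} r).IsSurreal := (isUSurreal_ofReal r).isSurreal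

theorem val_ofReal_eq (r : ℝ) : val (ofReal.{u} r) = val (realCut.{u} r) :=
  (val_eq_val (isSurreal_ofReal r) (isSurreal_realCut r)).2 (uniq_spec (isSurreal_realCut r)).2

/-- With its mirror image `mul_val_ofReal_lt`, this carries all size estimates for `s_ℝ`:
comparisons of `r` with rationals persist. Additivity and multiplicativity of `s_ℝ` are never
needed. -/
theorem lt_mul_val_ofReal {r : ℝ} {m : ℤ} {n : ℕ} (h : (m : ℝ) < n * r) :
    (m : Surreal.{u}) < n * val (ofReal.{u} r) := by
  have hn : n ≠ 0 ∨ n = 0 := (em _).symm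
  rcases hn with hn | rfl
  -- The left option of index `k` is at least `r - 1 / 2 ^ k`, so this `k` puts it above `m / n`.
  · obtain ⟨k, hk⟩ : ∃ k : ℕ, (n : ℝ) < 2 ^ k * (n * r - m) := by
      obtain ⟨k, hk⟩ := pow_unbounded_of_one_lt (n / (n * r - m)) one_lt_two
      exact ⟨k, (div_lt_iff₀ (sub_pos.2 h)).1 hk⟩
    have h₁ : val (ofDyadic.{u} k ⌈r * 2 ^ k - 1⌉) < val (ofReal.{u} r) := by
      rw [val_ofReal_eq, val_lt_val (ofDyadic_spec _ _).1 (isSurreal_realCut r)]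
      exact (isSurreal_realCut r).left_lt ⟨⟨k⟩, rfl⟩
    have h₂ : (m * 2 ^ k : ℝ) < n * ⌈r * 2 ^ k - 1⌉ := by
      have : (n : ℝ) * (r * 2 ^ k - 1) ≤ n * ⌈r * 2 ^ k - 1⌉ := by
        gcongr; exact Int.le_ceil _
      linarith
    have h₃ : (m * 2 ^ k : ℤ) < n * ⌈r * 2 ^ k - 1⌉ := by exact_mod_cast h₂
    have h₄ : (m * 2 ^ k : Surreal.{u}) < n * ⌈r * 2 ^ k - 1⌉ := by exact_mod_cast h₃
    have hk' : (0 : Surreal.{u}) < 2 ^ k := by positivity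
    have hn' : (0 : Surreal.{u}) < n := by positivity
    have e := (ofDyadic_spec.{u} k ⌈r * 2 ^ k - 1⌉).2.1
    rw [← e] at h₄
    have h₅ := mul_lt_mul_of_pos_left h₁ (mul_pos hn' hk')
    rw [← mul_lt_mul_iff_right₀ hk']
    linarith
  · simp only [Nat.cast_zero, zero_mul] at h ⊢
    exact_mod_cast h

theorem mul_val_ofReal_lt {r : ℝ} {m : ℤ} {n : ℕ} (h : (n * r : ℝ) < m) :
    n * val (ofReal.{u} r) < (m : Surreal.{u}) := by
  have hn : n ≠ 0 ∨ n = 0 := (em _).symm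
  rcases hn with hn | rfl
  · obtain ⟨k, hk⟩ : ∃ k : ℕ, (n : ℝ) < 2 ^ k * (m - n * r) := by
      obtain ⟨k, hk⟩ := pow_unbounded_of_one_lt (n / (m - n * r)) one_lt_two
      exact ⟨k, (div_lt_iff₀ (sub_pos.2 h)).1 hk⟩
    have h₁ : val (ofReal.{u} r) < val (ofDyadic.{u} k ⌊r * 2 ^ k + 1⌋) := by
      rw [val_ofReal_eq, val_lt_val (isSurreal_realCut r) (ofDyadic_spec _ _).1]
      exact (isSurreal_realCut r).lt_right ⟨⟨k⟩, rfl⟩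
    have h₂ : n * ⌊r * 2 ^ k + 1⌋ < (m * 2 ^ k : ℝ) := by
      have : (n : ℝ) * ⌊r * 2 ^ k + 1⌋ ≤ n * (r * 2 ^ k + 1) := by
        gcongr; exact Int.floor_le _
      linarith
    have h₃ : n * ⌊r * 2 ^ k + 1⌋ < (m * 2 ^ k : ℤ) := by exact_mod_cast h₂
    have h₄ : n * ⌊r * 2 ^ k + 1⌋ < (m * 2 ^ k : Surreal.{u}) := by exact_mod_cast h₃
    have hk' : (0 : Surreal.{u}) < 2 ^ k := by positivity
    have hn' : (0 : Surreal.{u}) < n := by positivity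
    have e := (ofDyadic_spec.{u} k ⌊r * 2 ^ k + 1⌋).2.1
    rw [← e] at h₄
    have h₅ := mul_lt_mul_of_pos_left h₁ (mul_pos hn' hk')
    rw [← mul_lt_mul_iff_right₀ hk']
    linarith
  · simp only [Nat.cast_zero, zero_mul] at h ⊢
    exact_mod_cast h

theorem val_ofReal_pos {r : ℝ} (h : 0 < r) : 0 < val (ofReal.{u} r) := by
  simpa using lt_mul_val_ofReal (m := 0) (n := 1) (by simpa using h)

/-! ### Estimates for real numbers -/

theorem exists_nat_abs_ofReal_le (r : ℝ) : ∃ n : ℕ, n ≠ 0 ∧ |val (ofReal.{u} r)| ≤ n := by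
  obtain ⟨n, hn⟩ := exists_nat_gt |r|
  refine ⟨n, ?_, ?_⟩
  · rintro rfl
    exact (abs_nonneg r).not_gt (by exact_mod_cast hn)
  · have h₁ := lt_mul_val_ofReal.{u} (r := r) (m := -n) (n := 1)
      (by push_cast; linarith [(abs_lt.1 hn).1])
    have h₂ := mul_val_ofReal_lt.{u} (r := r) (m := n) (n := 1)
      (by push_cast; linarith [(abs_lt.1 hn).2])
    push_cast at h₁ h₂
    exact abs_le.2 ⟨by linarith, by linarith⟩

theorem exists_nat_one_le_mul_sub {r t : ℝ} (h : r < t) :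
    ∃ n : ℕ, n ≠ 0 ∧ 1 ≤ n * (val (ofReal.{u} t) - val (ofReal.{u} r)) := by
  -- A gap larger than 3 between `n * r` and `n * t` leaves room for the consecutive integers `⌊n *
  -- r⌋ + 1` and `⌊n * r⌋ + 2`.
  obtain ⟨n, hn⟩ := exists_nat_gt (3 / (t - r))
  rw [div_lt_iff₀ (sub_pos.2 h)] at hn
  refine ⟨n, ?_, ?_⟩
  · rintro rfl
    norm_num at hn
  · have h₁ := mul_val_ofReal_lt.{u} (r := r) (m := ⌊n * r⌋ + 1) (n := n)
      (by push_cast; exact Int.lt_floor_add_one _)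
    have h₂ := lt_mul_val_ofReal.{u} (r := t) (m := ⌊n * r⌋ + 2) (n := n)
      (by push_cast; linarith [Int.floor_le (n * r)])
    push_cast at h₁ h₂
    linarith

theorem exists_nat_one_le_mul_abs {r : ℝ} (h : r ≠ 0) :
    ∃ n : ℕ, n ≠ 0 ∧ 1 ≤ n * |val (ofReal.{u} r)| := by
  obtain ⟨n, hn⟩ := exists_nat_gt (1 / |r|)
  rw [div_lt_iff₀ (abs_pos.2 h)] at hn
  refine ⟨n, ?_, ?_⟩
  · rintro rfl
    norm_num at hn
  · have h0 : (0 : Surreal.{u}) ≤ n := Nat.cast_nonneg n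
    rcases lt_or_gt_of_ne h with h | h
    · rw [abs_of_neg h] at hn
      have := mul_val_ofReal_lt.{u} (r := r) (m := -1) (n := n) (by push_cast; linarith)
      push_cast at this
      nlinarith [neg_abs_le (val (ofReal.{u} r))]
    · rw [abs_of_pos h] at hn
      have := lt_mul_val_ofReal.{u} (r := r) (m := 1) (n := n) (by push_cast; linarith)
      push_cast at this
      nlinarith [le_abs_self (val (ofReal.{u} r))]

/-! ### Powers of omega -/

theorem mem_opt_omegaPow_true {x a : PGame.{u}} : a ∈ (omegaPow x).opt true ↔
    a = 0 ∨ ∃ b ∈ x.opt true, ∃ r : ℝ, 0 < r ∧ a = ofReal r * omegaPow b := by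
  cases x
  constructor
  · rintro ⟨_ | ⟨i, ⟨r, hr⟩⟩, rfl⟩
    exacts [.inl rfl, .inr ⟨_, ⟨i, rfl⟩, r, hr, rfl⟩]
  · rintro (rfl | ⟨_, ⟨i, rfl⟩, r, hr, rfl⟩)
    exacts [⟨none, rfl⟩, ⟨some (i, ⟨r, hr⟩), rfl⟩]

theorem mem_opt_omegaPow_false {x a : PGame.{u}} : a ∈ (omegaPow x).opt false ↔
    ∃ b ∈ x.opt false, ∃ r : ℝ, 0 < r ∧ a = ofReal r * omegaPow b := by
  cases x
  constructor
  · rintro ⟨⟨i, ⟨r, hr⟩⟩, rfl⟩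
    exact ⟨_, ⟨i, rfl⟩, r, hr, rfl⟩
  · rintro ⟨_, ⟨i, rfl⟩, r, hr, rfl⟩
    exact ⟨(i, ⟨r, hr⟩), rfl⟩

theorem mul_lt_mul_of_infinitesimal {r t : ℝ} (hr : 0 < r) (ht : 0 < t) {a b : Surreal.{u}}
    (ha : 0 < a) (h : ∀ n : ℕ, n * a < b) :
    val (ofReal.{u} r) * a < val (ofReal.{u} t) * b := by
  obtain ⟨n, -, hn⟩ := exists_nat_abs_ofReal_le.{u} r
  obtain ⟨m, -, hm⟩ := exists_nat_one_le_mul_abs.{u} ht.ne'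
  have hr' := val_ofReal_pos.{u} hr
  have ht' := val_ofReal_pos.{u} ht
  rw [abs_of_pos hr'] at hn
  rw [abs_of_pos ht'] at hm
  calc val (ofReal.{u} r) * a ≤ n * a := by gcongr
    _ ≤ (m * val (ofReal.{u} t)) * (n * a) := le_mul_of_one_le_left (by positivity) hm
    _ = val (ofReal.{u} t) * ((m * n : ℕ) * a) := by push_cast; ring
    _ < val (ofReal.{u} t) * b := mul_lt_mul_of_pos_left (h _) ht'

theorem mul_lt_of_infinitesimal {r : ℝ} {a b : Surreal.{u}}
    (ha : 0 < a) (h : ∀ n : ℕ, n * a < b) : val (ofReal.{u} r) * a < b := by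
  obtain ⟨n, -, hn⟩ := exists_nat_abs_ofReal_le.{u} r
  exact lt_of_le_of_lt (mul_le_mul_of_nonneg_right (abs_le.1 hn).2 ha.le) (h n)

theorem lt_mul_of_infinitesimal {t : ℝ} (ht : 0 < t) {a b : Surreal.{u}}
    (ha : 0 < a) (h : ∀ n : ℕ, n * a < b) : a < val (ofReal.{u} t) * b := by
  obtain ⟨m, -, hm⟩ := exists_nat_one_le_mul_abs.{u} ht.ne'
  have ht' := val_ofReal_pos.{u} ht
  rw [abs_of_pos ht'] at hm
  calc a ≤ (m * val (ofReal.{u} t)) * a := le_mul_of_one_le_left ha.le hm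
    _ = val (ofReal.{u} t) * (m * a) := by ring
    _ < val (ofReal.{u} t) * b := mul_lt_mul_of_pos_left (h _) ht'

theorem nat_mul_lt_of_forall_ofReal_mul_lt {a b : Surreal.{u}} (ha : 0 < a)
    (h : ∀ r : ℝ, 0 < r → val (ofReal.{u} r) * a < b) (n : ℕ) : n * a < b := by
  have h₁ := lt_mul_val_ofReal.{u} (r := n + 1) (m := n) (n := 1) (by push_cast; linarith)
  push_cast at h₁
  rw [one_mul] at h₁
  exact (mul_lt_mul_of_pos_right h₁ ha).trans (h _ (by positivity))

theorem nat_mul_lt_of_forall_lt_ofReal_mul {a b : Surreal.{u}} (ha : 0 < a) (hb : 0 < b)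
    (h : ∀ r : ℝ, 0 < r → a < val (ofReal.{u} r) * b) (n : ℕ) : n * a < b := by
  -- The real `1 / (n + 2)` is small enough that `n + 1` copies of it stay below 1.
  have h₁ := mul_val_ofReal_lt.{u} (r := 1 / (n + 2)) (m := 1) (n := n + 1) (by
    push_cast
    rw [mul_one_div, div_lt_one (by positivity)]
    linarith)
  push_cast at h₁
  have h₂ := h (1 / (n + 2)) (by positivity)
  have hn : (0 : Surreal.{u}) ≤ n := Nat.cast_nonneg n
  calc n * a ≤ (n + 1) * a := by linarith
    _ ≤ (n + 1) * (val (ofReal.{u} (1 / (n + 2))) * b) := by gcongr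
    _ = (n + 1) * val (ofReal.{u} (1 / (n + 2))) * b := by ring
    _ < 1 * b := mul_lt_mul_of_pos_right h₁ hb
    _ = b := one_mul b

theorem val_pos_iff {x : PGame.{u}} (hx : x.IsSurreal) : 0 < val x ↔ 0 < x := by
  rw [← val_zero, val_lt_val isSurreal_zero hx]

/-- The bound `o` lets this be used inside the induction proving that powers are surreal. For `x <
y`, some left option `b` of `y` has `x ≤ b`, or some right option `a` of `x` has `a ≤ y`. All
positive real multiples of `ω^b` are left options of `ω^y`, and those of `ω^a` are right options of
`ω^x`, hence the infinite separation. -/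
theorem omegaPow_mono_of_isSurreal {o : Ordinal.{u}}
    (H : ∀ z : PGame.{u}, z.IsSurreal → z.birthday < o →
      (omegaPow z).IsSurreal ∧ 0 < val (omegaPow z))
    (x y : PGame.{u}) (hx : x.IsSurreal) (hy : y.IsSurreal) (hxo : x.birthday < o)
    (hyo : y.birthday < o) :
    (x ≤ y → val (omegaPow x) ≤ val (omegaPow y)) ∧
    (x < y → ∀ n : ℕ, n * val (omegaPow x) < val (omegaPow y)) := by
  induction x using opt_induction generalizing y with
  | ih x ihx =>
  induction y using opt_induction with
  | ih y ihy =>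
  have Hx := H x hx hxo
  have Hy := H y hy hyo
  have ihx' := fun s a (ha : a ∈ x.opt s) =>
    ihx s a ha y (hx.opt ha) hy ((birthday_lt_of_opt ha).trans hxo) hyo
  have ihy' := fun s b (hb : b ∈ y.opt s) =>
    ihy s b hb (hy.opt hb) ((birthday_lt_of_opt hb).trans hyo)
  have HX := fun s a (ha : a ∈ x.opt s) => H a (hx.opt ha) ((birthday_lt_of_opt ha).trans hxo)
  have HY := fun s a (ha : a ∈ y.opt s) => H a (hy.opt ha) ((birthday_lt_of_opt ha).trans hyo)
  constructor
  · intro hle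
    rw [val_le_val Hx.1 Hy.1]
    refine le_iff_opt.2 ⟨fun c hc => ?_, fun c hc => ?_⟩
    · refine not_le_of_gt ?_
      obtain rfl | ⟨a, ha, r, hr, rfl⟩ := mem_opt_omegaPow_true.1 hc
      · exact (val_pos_iff Hy.1).1 Hy.2
      · rw [← val_lt_val ((isSurreal_ofReal r).mul (HX _ a ha).1) Hy.1,
          val_mul (isSurreal_ofReal r) (HX _ a ha).1]
        exact mul_lt_of_infinitesimal (HX _ a ha).2
          ((ihx' _ a ha).2 ((hx.left_lt ha).trans_le hle))
    · refine not_le_of_gt ?_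
      obtain ⟨b, hb, r, hr, rfl⟩ := mem_opt_omegaPow_false.1 hc
      rw [← val_lt_val Hx.1 ((isSurreal_ofReal r).mul (HY _ b hb).1),
          val_mul (isSurreal_ofReal r) (HY _ b hb).1]
      exact lt_mul_of_infinitesimal hr Hx.2
          ((ihy' _ b hb).2 (hle.trans_lt (hy.lt_right hb)))
  · intro hlt n
    obtain ⟨b, hb, hle⟩ | ⟨a, ha, hle⟩ := not_le_iff_opt.1 hlt.2
    · refine lt_of_le_of_lt (mul_le_mul_of_nonneg_left ((ihy' _ b hb).1 hle) n.cast_nonneg) ?_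
      refine nat_mul_lt_of_forall_ofReal_mul_lt (HY _ b hb).2 (fun r hr => ?_) n
      have hs := (isSurreal_ofReal r).mul (HY _ b hb).1
      rw [← val_mul (isSurreal_ofReal r) (HY _ b hb).1, val_lt_val hs Hy.1]
      exact Hy.1.left_lt (mem_opt_omegaPow_true.2 (.inr ⟨b, hb, r, hr, rfl⟩))
    · refine lt_of_lt_of_le ?_ ((ihx' _ a ha).1 hle)
      refine nat_mul_lt_of_forall_lt_ofReal_mul Hx.2 (HX _ a ha).2 (fun r hr => ?_) n
      have hs := (isSurreal_ofReal r).mul (HX _ a ha).1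
      rw [← val_mul (isSurreal_ofReal r) (HX _ a ha).1, val_lt_val Hx.1 hs]
      exact Hx.1.lt_right (mem_opt_omegaPow_false.2 ⟨a, ha, r, hr, rfl⟩)

theorem isSurreal_omegaPow_and_pos (o : Ordinal.{u}) (x : PGame.{u}) (hx : x.IsSurreal)
    (hxo : x.birthday = o) : (omegaPow x).IsSurreal ∧ 0 < val (omegaPow x) := by
  induction o using WellFoundedLT.induction generalizing x with
  | ind o ih =>
  have H : ∀ z : PGame.{u}, z.IsSurreal → z.birthday < o →
      (omegaPow z).IsSurreal ∧ 0 < val (omegaPow z) := fun z hz h => ih _ h z hz rfl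
  have HX := fun s a (ha : a ∈ x.opt s) => H a (hx.opt ha) (hxo ▸ birthday_lt_of_opt ha)
  have hs : (omegaPow x).IsSurreal := by
    refine isSurreal_of_opt (fun c hc d hd => ?_) (fun s c hc => ?_)
    · obtain ⟨b, hb, t, ht, rfl⟩ := mem_opt_omegaPow_false.1 hd
      have hbs := (isSurreal_ofReal t).mul (HX _ b hb).1
      obtain rfl | ⟨a, ha, r, hr, rfl⟩ := mem_opt_omegaPow_true.1 hc
      · rw [← val_pos_iff hbs, val_mul (isSurreal_ofReal t) (HX _ b hb).1]
        exact mul_pos (val_ofReal_pos ht) (HX _ b hb).2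
      · rw [← val_lt_val ((isSurreal_ofReal r).mul (HX _ a ha).1) hbs,
          val_mul (isSurreal_ofReal r) (HX _ a ha).1, val_mul (isSurreal_ofReal t) (HX _ b hb).1]
        exact mul_lt_mul_of_infinitesimal hr ht (HX _ a ha).2
          ((omegaPow_mono_of_isSurreal H a b (hx.opt ha) (hx.opt hb)
            (hxo ▸ birthday_lt_of_opt ha) (hxo ▸ birthday_lt_of_opt hb)).2
            ((hx.left_lt ha).trans (hx.lt_right hb)))
    · cases s
      · obtain ⟨a, ha, r, hr, rfl⟩ := mem_opt_omegaPow_false.1 hc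
        exact (isSurreal_ofReal r).mul (HX _ a ha).1
      · obtain rfl | ⟨a, ha, r, hr, rfl⟩ := mem_opt_omegaPow_true.1 hc
        · exact isSurreal_zero
        · exact (isSurreal_ofReal r).mul (HX _ a ha).1
  exact ⟨hs, (val_pos_iff hs).2 (hs.left_lt (mem_opt_omegaPow_true.2 (.inl rfl)))⟩

theorem IsSurreal.omegaPow {x : PGame.{u}} (hx : x.IsSurreal) : (omegaPow x).IsSurreal :=
  (isSurreal_omegaPow_and_pos _ x hx rfl).1

theorem val_omegaPow_pos {x : PGame.{u}} (hx : x.IsSurreal) : 0 < val (omegaPow x) :=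
  (isSurreal_omegaPow_and_pos _ x hx rfl).2

theorem val_omegaPow_le {x y : PGame.{u}} (hx : x.IsSurreal) (hy : y.IsSurreal) (h : x ≤ y) :
    val (omegaPow x) ≤ val (omegaPow y) :=
  (omegaPow_mono_of_isSurreal (o := Order.succ (max x.birthday y.birthday))
    (fun _ hz _ => ⟨hz.omegaPow, val_omegaPow_pos hz⟩) x y hx hy
    (Order.lt_succ_iff.2 (le_max_left _ _)) (Order.lt_succ_iff.2 (le_max_right _ _))).1 h

theorem nat_mul_val_omegaPow_lt {x y : PGame.{u}} (hx : x.IsSurreal) (hy : y.IsSurreal)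
    (h : x < y) (n : ℕ) : n * val (omegaPow x) < val (omegaPow y) :=
  (omegaPow_mono_of_isSurreal (o := Order.succ (max x.birthday y.birthday))
    (fun _ hz _ => ⟨hz.omegaPow, val_omegaPow_pos hz⟩) x y hx hy
    (Order.lt_succ_iff.2 (le_max_left _ _)) (Order.lt_succ_iff.2 (le_max_right _ _))).2 h n

/-! ### Leading terms -/

/-- `a` and `b` are commensurate. -/
def Commensurate (a b : Surreal.{u}) : Prop := ∃ n : ℕ, a ≤ n * b ∧ b ≤ n * a

theorem Commensurate.trans {a b c : Surreal.{u}} (h : Commensurate a b) (h' : Commensurate b c) :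
    Commensurate a c := by
  obtain ⟨n, h₁, h₂⟩ := h
  obtain ⟨m, h₃, h₄⟩ := h'
  have hn : (0 : Surreal.{u}) ≤ n := n.cast_nonneg
  have hm : (0 : Surreal.{u}) ≤ m := m.cast_nonneg
  refine ⟨n * m, ?_, ?_⟩ <;> push_cast
  · calc a ≤ n * b := h₁
      _ ≤ n * (m * c) := by gcongr
      _ = n * m * c := by ring
  · calc c ≤ m * b := h₄
      _ ≤ m * (n * a) := by gcongr
      _ = n * m * a := by ring

/-- If a positive option is commensurate with `x`, its power serves for `x`. Otherwise the powers
commensurate with the positive left options are infinitely below `x`, and those of the right options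
infinitely above. The number `y` cut out by their exponents then satisfies `x ≈ ω^y`, as the options
of each side are separated by the other number. -/
theorem exists_commensurate_omegaPow {x : PGame.{u}} (hx : x.IsSurreal) (h0 : 0 < x) :
    ∃ y : PGame.{u}, y.IsSurreal ∧ Commensurate (val x) (val (omegaPow y)) := by
  induction x using opt_induction with
  | ih x ih =>
  have hx0 := (val_pos_iff hx).2 h0
  by_cases hc : ∃ a, IsOption a x ∧ 0 < a ∧ Commensurate (val x) (val a)
  · obtain ⟨a, ⟨s, ha⟩, ha0, hc⟩ := hc
    obtain ⟨y, hy, h⟩ := ih s a ha (hx.opt ha) ha0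
    exact ⟨y, hy, hc.trans h⟩
  have hL : ∀ a ∈ x.opt true, 0 < a → ∃ y : PGame.{u}, y.IsSurreal ∧
      (∀ n : ℕ, n * val (omegaPow y) < val x) ∧ ∃ n : ℕ, val a ≤ n * val (omegaPow y) := by
    intro a ha ha0
    obtain ⟨y, hy, k, h₁, h₂⟩ := ih _ a ha (hx.opt ha) ha0
    refine ⟨y, hy, fun n => ?_, k, h₁⟩
    by_contra hcon
    -- If `x ≤ n ω^y`, then `x ≤ n k a`; the added 1 secures the reverse bound from `a < x`.
    refine hc ⟨a, ⟨_, ha⟩, ha0, n * k + 1, ?_, ?_⟩ <;> push_cast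
    · have : (n : Surreal.{u}) * val (omegaPow y) ≤ n * (k * val a) := by gcongr
      linarith [(val_pos_iff (hx.opt ha)).2 ha0]
    · have : 0 ≤ (n * k : Surreal.{u}) * val x := by positivity
      linarith [(val_lt_val (hx.opt ha) hx).2 (hx.left_lt ha)]
  have hR : ∀ a ∈ x.opt false, ∃ y : PGame.{u}, y.IsSurreal ∧
      (∀ n : ℕ, n * val x < val (omegaPow y)) ∧ ∃ n : ℕ, val (omegaPow y) ≤ n * val a := by
    intro a ha
    have hax := hx.lt_right ha
    have ha0 := (h0.trans hax)
    have hav := (val_pos_iff (hx.opt ha)).2 ha0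
    obtain ⟨y, hy, k, h₁, h₂⟩ := ih _ a ha (hx.opt ha) ha0
    refine ⟨y, hy, fun n => ?_, k, h₂⟩
    by_contra hcon
    refine hc ⟨a, ⟨_, ha⟩, ha0, k * n + 1, ?_, ?_⟩ <;> push_cast
    · have : 0 ≤ (k * n : Surreal.{u}) * val a := by positivity
      linarith [(val_lt_val hx (hx.opt ha)).2 hax]
    · have : (k : Surreal.{u}) * val (omegaPow y) ≤ k * (n * val x) := by
        gcongr; exact not_lt.1 hcon
      linarith
  obtain ⟨y, hyL, hyR, hL', hR'⟩ : ∃ y : PGame.{u},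
      (∀ b ∈ y.opt true, b.IsSurreal ∧ ∀ n : ℕ, n * val (omegaPow b) < val x) ∧
      (∀ b ∈ y.opt false, b.IsSurreal ∧ ∀ n : ℕ, n * val x < val (omegaPow b)) ∧
      (∀ a ∈ x.opt true, 0 < a → ∃ b ∈ y.opt true, ∃ n : ℕ, val a ≤ n * val (omegaPow b)) ∧
      ∀ a ∈ x.opt false, ∃ b ∈ y.opt false, ∃ n : ℕ, val (omegaPow b) ≤ n * val a := by
    cases x with
    | mk ι κ L R =>
      choose fL hfL using fun i : {i : ι // 0 < L i} => hL (L i.1) ⟨i.1, rfl⟩ i.2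
      choose fR hfR using fun j => hR (R j) ⟨j, rfl⟩
      refine ⟨mk _ _ fL fR, ?_, ?_, ?_, ?_⟩
      · rintro _ ⟨i, rfl⟩; exact ⟨(hfL i).1, (hfL i).2.1⟩
      · rintro _ ⟨i, rfl⟩; exact ⟨(hfR i).1, (hfR i).2.1⟩
      · rintro _ ⟨i, rfl⟩ hi; exact ⟨_, ⟨⟨i, hi⟩, rfl⟩, (hfL ⟨i, hi⟩).2.2⟩
      · rintro _ ⟨i, rfl⟩; exact ⟨_, ⟨i, rfl⟩, (hfR i).2.2⟩
  have hy : y.IsSurreal := by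
    refine isSurreal_iff.2 ⟨fun a ha b hb hle => ?_, fun s a ha => ?_⟩
    · have h₁ := (hyL a ha).2 1
      have h₂ := (hyR b hb).2 1
      have h₃ := val_omegaPow_le (hyR b hb).1 (hyL a ha).1 hle
      push_cast at h₁ h₂
      linarith
    · cases s
      exacts [(hyR a ha).1, (hyL a ha).1]
  refine ⟨y, hy, ?_⟩
  have hw := val_omegaPow_pos hy
  have key : x ≈ omegaPow y := by
    refine ⟨le_iff_opt.2 ⟨fun a ha => ?_, fun c hc => ?_⟩,
      le_iff_opt.2 ⟨fun c hc => ?_, fun a ha => ?_⟩⟩ <;> refine not_le_of_gt ?_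
    · rw [← val_lt_val (hx.opt ha) hy.omegaPow]
      rcases lt_or_ge 0 (val a) with h | h
      · obtain ⟨b, hb, n, hn⟩ := hL' a ha ((val_pos_iff (hx.opt ha)).1 h)
        exact hn.trans_lt (nat_mul_val_omegaPow_lt (hyL b hb).1 hy (hy.left_lt hb) n)
      · exact h.trans_lt hw
    · obtain ⟨b, hb, r, hr, rfl⟩ := mem_opt_omegaPow_false.1 hc
      rw [← val_lt_val hx ((isSurreal_ofReal r).mul (hyR b hb).1.omegaPow),
        val_mul (isSurreal_ofReal r) (hyR b hb).1.omegaPow]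
      exact lt_mul_of_infinitesimal hr hx0 (hyR b hb).2
    · obtain rfl | ⟨b, hb, r, hr, rfl⟩ := mem_opt_omegaPow_true.1 hc
      · exact h0
      · rw [← val_lt_val ((isSurreal_ofReal r).mul (hyL b hb).1.omegaPow) hx,
          val_mul (isSurreal_ofReal r) (hyL b hb).1.omegaPow]
        exact mul_lt_of_infinitesimal (val_omegaPow_pos (hyL b hb).1) (hyL b hb).2
    · rw [← val_lt_val hy.omegaPow (hx.opt ha)]
      obtain ⟨b, hb, n, hn⟩ := hR' a ha
      have h := nat_mul_val_omegaPow_lt hy (hyR b hb).1 (hy.lt_right hb) n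
      exact lt_of_mul_lt_mul_left (h.trans_le hn) n.cast_nonneg
  rw [(val_eq_val hx hy.omegaPow).2 key]
  exact ⟨1, by simp, by simp⟩

/-- `s_ℝ(r) * w` is the leading term of `v`, relative to the scale `w`. -/
def IsLeading (r : ℝ) (w v : Surreal.{u}) : Prop :=
  ∀ n : ℕ, n ≠ 0 → n * |v - val (ofReal.{u} r) * w| < w

/-- The coefficient is the supremum of the rationals `m / n` with `m * w ≤ n * v`; the hypothesis
makes this set nonempty and bounded. No inverse of `w` is needed. -/
theorem exists_isLeading {v w : Surreal.{u}} (hw : 0 < w) {k : ℕ} (h : |v| ≤ k * w) :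
    ∃ r : ℝ, IsLeading r w v := by
  set S : Set ℝ := {q | ∃ m : ℤ, ∃ n : ℕ, n ≠ 0 ∧ q = m / n ∧ m * w ≤ n * v} with hS
  obtain ⟨hv₁, hv₂⟩ := abs_le.1 h
  have hne : S.Nonempty := ⟨_, -k, 1, one_ne_zero, rfl, by push_cast; linarith⟩
  have hbdd : BddAbove S := by
    refine ⟨k, ?_⟩
    rintro _ ⟨m, n, hn, rfl, hmn⟩
    have hn' : (0 : ℝ) < n := by positivity
    rw [div_le_iff₀ hn']
    have h₁ : (m : Surreal.{u}) * w ≤ (k * n : Surreal.{u}) * w := by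
      calc (m : Surreal.{u}) * w ≤ n * v := hmn
        _ ≤ n * (k * w) := by gcongr
        _ = k * n * w := by ring
    have h₂ := le_of_mul_le_mul_right h₁ hw
    exact_mod_cast h₂
  have lower : ∀ (m : ℤ) (n : ℕ), n ≠ 0 → (m : ℝ) < n * sSup S → m * w ≤ n * v := by
    intro m n hn hlt
    have hn' : (0 : ℝ) < n := by positivity
    obtain ⟨_, ⟨m', n', hn₀, rfl, h'⟩, hq⟩ := exists_lt_of_lt_csSup hne
      ((div_lt_iff₀' hn').2 hlt)
    have hn₁ : (0 : ℝ) < n' := by positivity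
    rw [div_lt_div_iff₀ hn' hn₁] at hq
    have hq' : m * n' < m' * n := by exact_mod_cast hq
    have hq₂ : (m * n' : Surreal.{u}) < m' * n := by exact_mod_cast hq'
    have hn₂ : (0 : Surreal.{u}) < n' := by positivity
    refine le_of_mul_le_mul_left ?_ hn₂
    calc (n' : Surreal.{u}) * (m * w) = m * n' * w := by ring
      _ ≤ m' * n * w := by gcongr
      _ = n * (m' * w) := by ring
      _ ≤ n * (n' * v) := by gcongr
      _ = n' * (n * v) := by ring
  have upper : ∀ (m : ℤ) (n : ℕ), n ≠ 0 → (n * sSup S : ℝ) < m → n * v ≤ m * w := by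
    intro m n hn hlt
    by_contra hcon
    have hn' : (0 : ℝ) < n := by positivity
    have := le_csSup hbdd ⟨m, n, hn, rfl, (not_le.1 hcon).le⟩
    rw [div_le_iff₀' hn'] at this
    linarith
  refine ⟨sSup S, fun n hn => ?_⟩
  set r := sSup S
  -- Since `4 n r` lies strictly between `m` and `m + 2`, both `4 n v` and `4 n s_ℝ(r) w` lie
  -- between `m w` and `(m + 2) w`. They differ by at most `2 w`, so `n` times the error is at most
  -- `w / 2`.
  set m : ℤ := ⌈((4 * n : ℕ) : ℝ) * r⌉ - 1 with hm
  have hn4 : 4 * n ≠ 0 := by positivity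
  have e₁ : (m : ℝ) < (4 * n : ℕ) * r := by
    rw [hm, Int.cast_sub, Int.cast_one]
    linarith [Int.ceil_lt_add_one (((4 * n : ℕ) : ℝ) * r)]
  have e₂ : ((4 * n : ℕ) * r : ℝ) < (m + 2 : ℤ) := by
    rw [hm]
    push_cast
    have := Int.le_ceil (((4 * n : ℕ) : ℝ) * r)
    push_cast at this
    linarith
  have h₁ := lower _ _ hn4 e₁
  have h₂ := upper _ _ hn4 e₂
  have h₃ := mul_le_mul_of_nonneg_right (lt_mul_val_ofReal.{u} e₁).le hw.le
  have h₄ := mul_le_mul_of_nonneg_right (mul_val_ofReal_lt.{u} e₂).le hw.le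
  push_cast at h₁ h₂ h₃ h₄
  have hn0 : (0 : Surreal.{u}) < n := by positivity
  have h₅ : |4 * n * (v - val (ofReal.{u} r) * w)| ≤ 2 * w :=
    abs_le.2 ⟨by linarith, by linarith⟩
  rw [abs_mul, abs_of_pos (by positivity)] at h₅
  linarith

theorem IsLeading.exists_le {r : ℝ} {w v : Surreal.{u}} (h : IsLeading r w v) (hr : r ≠ 0)
    (hw : 0 < w) : ∃ n : ℕ, w ≤ n * |v| := by
  obtain ⟨n, hn, h₁⟩ := exists_nat_one_le_mul_abs.{u} hr
  have h₂ := h (2 * n) (by positivity)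
  have h₃ : |val (ofReal.{u} r)| * w ≤ |v| + |v - val (ofReal.{u} r) * w| := by
    have := abs_sub_le (val (ofReal.{u} r) * w) v 0
    rw [sub_zero, sub_zero, abs_mul, abs_of_pos hw, abs_sub_comm] at this
    linarith
  have hn0 : (0 : Surreal.{u}) < n := by positivity
  have h₄ := mul_le_mul_of_nonneg_right h₁ hw.le
  have h₅ := mul_le_mul_of_nonneg_left h₃ hn0.le
  refine ⟨2 * n, ?_⟩
  push_cast at h₂ ⊢
  linarith

theorem IsLeading.exists_ge {r : ℝ} {w v : Surreal.{u}} (h : IsLeading r w v)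
    (hw : 0 < w) : ∃ n : ℕ, |v| ≤ n * w := by
  obtain ⟨n, hn, h₁⟩ := exists_nat_abs_ofReal_le.{u} r
  have h₂ := h 1 one_ne_zero
  have h₃ : |v| ≤ |v - val (ofReal.{u} r) * w| + |val (ofReal.{u} r)| * w := by
    have := abs_sub_le v (val (ofReal.{u} r) * w) 0
    rwa [sub_zero, sub_zero, abs_mul _ w, abs_of_pos hw] at this
  have h₄ := mul_le_mul_of_nonneg_right h₁ hw.le
  refine ⟨n + 1, ?_⟩
  push_cast at h₂ ⊢
  linarith

theorem not_isLeading_zero {r : ℝ} (hr : r ≠ 0) {w : Surreal.{u}} (hw : 0 < w) :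
    ¬ IsLeading r w 0 := by
  intro h
  obtain ⟨n, hn⟩ := h.exists_le hr hw
  rw [abs_zero, mul_zero] at hn
  exact hn.not_gt hw

/-- Two coefficients differ by at least `1 / n` for some `n`, while both errors are below `w / (2
n)`. -/
theorem IsLeading.unique_coeff {r t : ℝ} {w v : Surreal.{u}} (hr : IsLeading r w v)
    (ht : IsLeading t w v) : r = t := by
  have aux : ∀ {r t : ℝ}, IsLeading r w v → IsLeading t w v → ¬ r < t := by
    intro r t hr ht hlt
    obtain ⟨n, hn, h⟩ := exists_nat_one_le_mul_sub.{u} hlt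
    have h₁ := hr (2 * n) (by positivity)
    have h₂ := ht (2 * n) (by positivity)
    have hn0 : (0 : Surreal.{u}) < n := by positivity
    have h₃ : |v - val (ofReal.{u} r) * w| ≥ v - val (ofReal.{u} r) * w := le_abs_self _
    have h₄ : |v - val (ofReal.{u} t) * w| ≥ -(v - val (ofReal.{u} t) * w) := neg_le_abs _
    have hw : 0 < w := lt_of_le_of_lt (by positivity) h₁
    have h₅ := mul_le_mul_of_nonneg_right h hw.le
    push_cast at h₁ h₂
    have h₆ := mul_le_mul_of_nonneg_left (add_le_add h₃ h₄) hn0.le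
    linarith
  exact le_antisymm (not_lt.1 (aux ht hr)) (not_lt.1 (aux hr ht))

/-- Any coefficient bounds `|v|` by a multiple of `ω^x`, and a nonzero one bounds `ω^y` by a
multiple of `|v|`. So `ω^y` is at most a multiple of `ω^x`, which excludes `x < y`. -/
theorem IsLeading.exponent_le {r t : ℝ} {v : Surreal.{u}} {x y : PGame.{u}} (hx : x.IsSurreal)
    (hy : y.IsSurreal) (ht : t ≠ 0) (h₁ : IsLeading r (val (omegaPow x)) v)
    (h₂ : IsLeading t (val (omegaPow y)) v) : y ≤ x := by
  by_contra hcon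
  have hlt := hx.lt_of_not_le hy hcon
  obtain ⟨n, hn⟩ := h₁.exists_ge (val_omegaPow_pos hx)
  obtain ⟨m, hm⟩ := h₂.exists_le ht (val_omegaPow_pos hy)
  have h₃ := nat_mul_val_omegaPow_lt hx hy hlt (m * n)
  have h₄ := mul_le_mul_of_nonneg_left hn (Nat.cast_nonneg (α := Surreal.{u}) m)
  push_cast at h₃
  linarith

theorem exists_leading_term {v : Surreal.{u}} (hv : v ≠ 0) :
    ∃ (y : PGame.{u}) (r : ℝ), y.IsUSurreal ∧ r ≠ 0 ∧ IsLeading r (val (omegaPow y)) v := by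
  obtain ⟨x, hx, hxv⟩ := exists_val_eq |v|
  obtain ⟨z, hz, hxz⟩ := exists_commensurate_omegaPow hx
    ((val_pos_iff hx).1 (hxv ▸ abs_pos.2 hv))
  obtain ⟨y, hy, hyz⟩ := exists_isUSurreal hz
  have e : val (omegaPow y) = val (omegaPow z) :=
    le_antisymm (val_omegaPow_le hy.isSurreal hz hyz.1) (val_omegaPow_le hz hy.isSurreal hyz.2)
  rw [hxv, ← e] at hxz
  obtain ⟨n, h₁, h₂⟩ := hxz
  have hw := val_omegaPow_pos hy.isSurreal
  obtain ⟨r, hr⟩ := exists_isLeading hw h₁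
  refine ⟨y, r, hy, ?_, hr⟩
  rintro rfl
  have hn : n ≠ 0 := by
    rintro rfl
    rw [Nat.cast_zero, zero_mul] at h₂
    exact h₂.not_gt hw
  have hn0 : (0 : Surreal.{u}) < n := by positivity
  have h₃ := hr (2 * n) (by positivity)
  -- A zero coefficient contradicts `ω^y ≤ n |v|`: the bound `4 n |s_ℝ(0)| ≤ 1` and an error below
  -- `ω^y / (2 n)` leave `n |v|` below `ω^y`.
  have h₄ := lt_mul_val_ofReal.{u} (r := 0) (m := -1) (n := 4 * n) (by simp)
  have h₅ := mul_val_ofReal_lt.{u} (r := 0) (m := 1) (n := 4 * n) (by simp)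
  push_cast at h₃ h₄ h₅
  have h₆ : |4 * n * val (ofReal.{u} 0)| ≤ 1 := abs_le.2 ⟨by linarith, h₅.le⟩
  rw [abs_mul, abs_of_pos (by positivity)] at h₆
  have h₇ : |v| ≤ |v - val (ofReal.{u} 0) * val (omegaPow y)| +
      |val (ofReal.{u} 0)| * val (omegaPow y) := by
    have := abs_sub_le v (val (ofReal.{u} 0) * val (omegaPow y)) 0
    rwa [sub_zero, sub_zero, abs_mul _ (val (omegaPow y)), abs_of_pos hw] at this
  have h₈ := mul_le_mul_of_nonneg_left h₇ hn0.le
  have h₉ := mul_le_mul_of_nonneg_right h₆ hw.le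
  linarith

/-! ### Simplest elements of convex classes -/

/-- `s` is the simplest canonical representative in `I`. -/
def IsSimplest (I : Set PGame.{u}) (s : PGame.{u}) : Prop :=
  s.IsUSurreal ∧ s ∈ I ∧
    ∀ a : PGame.{u}, a.IsUSurreal → a ≠ s → a ∈ I → s.birthday < a.birthday

theorem IsSimplest.unique {I : Set PGame.{u}} {s t : PGame.{u}} (hs : IsSimplest I s)
    (ht : IsSimplest I t) : s = t := by
  by_contra h
  exact lt_asymm (hs.2.2 t ht.1 (Ne.symm h) ht.2.1) (ht.2.2 s hs.1 h hs.2.1)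

theorem IsSimplest.birthday_le {I : Set PGame.{u}} {s a : PGame.{u}} (hs : IsSimplest I s)
    (ha : a.IsUSurreal) (h : a ∈ I) : s.birthday ≤ a.birthday := by
  by_cases e : a = s
  · rw [e]
  · exact (hs.2.2 a ha e h).le

/-- If `a < b` were both of least birthday in `I`, an option of one of them would lie between them,
hence in `I` by convexity, and be younger. So the members of least birthday are all equivalent.
Convexity also keeps canonical representatives inside `I`. -/
theorem exists_isSimplest {I : Set PGame.{u}} (hI : I.Nonempty)
    (hs : ∀ a ∈ I, a.IsSurreal)
    (hc : ∀ a ∈ I, ∀ b ∈ I, ∀ c : PGame.{u}, c.IsSurreal → a ≤ c → c ≤ b → c ∈ I) :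
    ∃ s, IsSimplest I s := by
  have rep : ∀ a ∈ I, ∃ b : PGame.{u}, b.IsUSurreal ∧ b ∈ I ∧ b.birthday ≤ a.birthday := by
    intro a ha
    obtain ⟨b, hb, hba⟩ := exists_isUSurreal (hs a ha)
    exact ⟨b, hb, hc a ha a ha b hb.isSurreal hba.2 hba.1, hb.birthday_le (hs a ha) hba⟩
  obtain ⟨x, hx⟩ := hI
  obtain ⟨x', hx', hx'I, -⟩ := rep x hx
  obtain ⟨s, ⟨hsU, hsI⟩, hmin⟩ := (InvImage.wf birthday.{u} Ordinal.lt_wf).has_min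
    {a | a.IsUSurreal ∧ a ∈ I} ⟨x', hx', hx'I⟩
  have hmin' : ∀ a ∈ I, s.birthday ≤ a.birthday := by
    intro a ha
    obtain ⟨b, hb, hbI, hle⟩ := rep a ha
    exact (not_lt.1 (hmin b ⟨hb, hbI⟩)).trans hle
  have key : ∀ a ∈ I, ∀ b ∈ I, a.birthday = s.birthday → b.birthday = s.birthday → ¬ a < b := by
    intro a ha b hb hab hbb hlt
    obtain ⟨c, hcb, hle⟩ | ⟨c, hca, hle⟩ := not_le_iff_opt.1 hlt.2
    · have := hmin' c (hc a ha b hb c ((hs b hb).opt hcb) hle ((hs b hb).left_lt hcb).le)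
      exact (this.trans_lt (birthday_lt_of_opt hcb)).ne' hbb
    · have := hmin' c (hc a ha b hb c ((hs a ha).opt hca) ((hs a ha).lt_right hca).le hle)
      exact (this.trans_lt (birthday_lt_of_opt hca)).ne' hab
  refine ⟨s, hsU, hsI, fun a haU hne ha => (hmin' a ha).lt_of_ne' fun e => ?_⟩
  obtain h | h | h := lt_or_equiv_or_gt haU.isSurreal hsU.isSurreal
  · exact key a ha s hsI e rfl h
  · exact hne (haU.eq_of_equiv hsU h)
  · exact key s hsI a ha rfl e h

/-! ### Terms of a transfinite sum -/

/-- This moves the term condition into the ordered ring, as a statement about the leading term of `x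
- s_γ`. -/
theorem isTerm_iff {γ : Ordinal.{u}} {s y : Ordinal.{u} → PGame.{u}} {r : Ordinal.{u} → ℝ}
    {x : PGame.{u}} (hs : (s γ).IsSurreal) (hy : (y γ).IsSurreal) (hx : x.IsSurreal) :
    IsTerm γ s y r x ↔ IsLeading (r γ) (val (omegaPow (y γ))) (val x - val (s γ)) := by
  have hm := (isSurreal_ofReal (r γ)).mul hy.omegaPow
  have hd := hx.sub (hs.add hm)
  refine forall₂_congr fun n _ => ?_
  rw [← val_lt_val ((isSurreal_absVal hd).mul (isSurreal_ofInt n)) hy.omegaPow,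
    val_mul (isSurreal_absVal hd) (isSurreal_ofInt n), val_absVal hd, val_sub hx (hs.add hm),
    val_add hs hm, val_mul (isSurreal_ofReal _) hy.omegaPow, val_ofInt, Int.cast_natCast,
    mul_comm, sub_add_eq_sub_sub]

theorem inTerms_congr {β : Ordinal.{u}} {s y s' y' : Ordinal.{u} → PGame.{u}}
    {r r' : Ordinal.{u} → ℝ} (h : ∀ γ < β, s γ = s' γ ∧ y γ = y' γ ∧ r γ = r' γ) (x : PGame.{u}) :
    InTerms β s y r x ↔ InTerms β s' y' r' x := by
  refine and_congr_right fun _ => forall₂_congr fun γ hγ => ?_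
  obtain ⟨h₁, h₂, h₃⟩ := h γ hγ
  rw [IsTerm, IsTerm, h₁, h₂, h₃]

theorem InTerms.mono {β γ : Ordinal.{u}} {s y : Ordinal.{u} → PGame.{u}} {r : Ordinal.{u} → ℝ}
    {x : PGame.{u}} (h : InTerms β s y r x) (hγ : γ ≤ β) : InTerms γ s y r x :=
  ⟨h.1, fun δ hδ => h.2 δ (hδ.trans_le hγ)⟩

theorem exists_isSimplest_inTerms {β : Ordinal.{u}} {s y : Ordinal.{u} → PGame.{u}}
    {r : Ordinal.{u} → ℝ} {x : PGame.{u}} (hs : ∀ γ < β, (s γ).IsSurreal)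
    (hy : ∀ γ < β, (y γ).IsSurreal) (hx : InTerms β s y r x) :
    ∃ t, IsSimplest {a | InTerms β s y r a} t := by
  refine exists_isSimplest ⟨x, hx⟩ (fun a ha => ha.1) fun a ha b hb c hcs hac hcb =>
    ⟨hcs, fun γ hγ => (isTerm_iff (hs γ hγ) (hy γ hγ) hcs).2 fun n hn => ?_⟩
  have h₁ := (isTerm_iff (hs γ hγ) (hy γ hγ) ha.1).1 (ha.2 γ hγ) n hn
  have h₂ := (isTerm_iff (hs γ hγ) (hy γ hγ) hb.1).1 (hb.2 γ hγ) n hn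
  have hn0 : (0 : Surreal.{u}) < n := by positivity
  rw [← val_le_val ha.1 hcs] at hac
  rw [← val_le_val hcs hb.1] at hcb
  rw [← abs_of_pos hn0, ← abs_mul, abs_lt] at h₁ h₂ ⊢
  have h₃ := mul_le_mul_of_nonneg_left hac hn0.le
  have h₄ := mul_le_mul_of_nonneg_left hcb hn0.le
  constructor <;> linarith [h₁.1, h₂.2]

theorem simplestOn_zero_iff {s y : Ordinal.{u} → PGame.{u}} {r : Ordinal.{u} → ℝ} :
    SimplestOn 0 s y r ↔ s 0 ≈ 0 := by
  simp [SimplestOn]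

theorem simplestOn_iff {β : Ordinal.{u}} (hβ : 0 < β) {s y : Ordinal.{u} → PGame.{u}}
    {r : Ordinal.{u} → ℝ} : SimplestOn β s y r ↔ IsSimplest {a | InTerms β s y r a} (s β) := by
  simp [SimplestOn, hβ, hβ.ne', IsSimplest]

/-- Index 0 needs no separate treatment in the construction: the class there contains all surreal
numbers, and its simplest element is the canonical zero, since nothing is born before birthday 0. -/
theorem simplestOn_of_isSimplest {β : Ordinal.{u}} {s y : Ordinal.{u} → PGame.{u}}
    {r : Ordinal.{u} → ℝ} (h : IsSimplest {a | InTerms β s y r a} (s β)) : SimplestOn β s y r := by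
  obtain rfl | hβ := eq_or_ne β 0
  · rw [simplestOn_zero_iff]
    obtain ⟨h₀, h₁⟩ := uniq_spec isSurreal_zero.{u}
    by_cases e : uniq 0 = s 0
    · rwa [← e]
    · have h₂ := h.2.2 _ h₀ e ⟨h₀.isSurreal, fun γ hγ => (not_lt_zero hγ).elim⟩
      have h₃ : (0 : PGame.{u}).birthday ≤ 0 :=
        birthday_le_iff.2 fun s a ha => (notMem_opt_zero s a ha).elim
      exact absurd (h₂.trans_le ((h₀.birthday_le isSurreal_zero h₁).trans h₃)) not_lt_zero
  · exact (simplestOn_iff (pos_iff_ne_zero.2 hβ)).2 h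

theorem simplestOn_unique {β : Ordinal.{u}} {s y s' y' : Ordinal.{u} → PGame.{u}}
    {r r' : Ordinal.{u} → ℝ} (h : ∀ γ < β, s γ = s' γ ∧ y γ = y' γ ∧ r γ = r' γ)
    (hs : (s β).IsUSurreal) (hs' : (s' β).IsUSurreal) (h₁ : SimplestOn β s y r)
    (h₂ : SimplestOn β s' y' r') : s β = s' β := by
  obtain rfl | hβ := eq_or_ne β 0
  · exact hs.eq_of_equiv hs' (equiv_trans (h₁.1 rfl) (equiv_symm (h₂.1 rfl)))
  · rw [simplestOn_iff (pos_iff_ne_zero.2 hβ)] at h₁ h₂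
    simp only [← inTerms_congr h] at h₂
    exact h₁.unique h₂

theorem isSum_unique {θ : Ordinal.{u}} {y : Ordinal.{u} → PGame.{u}} {r : Ordinal.{u} → ℝ}
    {z z' : PGame.{u}} (h : IsSum θ y r z) (h' : IsSum θ y r z') : z = z' := by
  obtain ⟨s, hs, hss, rfl⟩ := h
  obtain ⟨s', hs', hss', rfl⟩ := h'
  have : ∀ β ≤ θ, s β = s' β := by
    intro β
    induction β using WellFoundedLT.induction with
    | ind β ih =>
      intro hβ
      exact simplestOn_unique (fun γ hγ => ⟨ih γ hγ (hγ.le.trans hβ), rfl, rfl⟩) (hs β hβ)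
        (hs' β hβ) (hss β hβ) (hss' β hβ)
  exact this θ le_rfl

/-- Here `a` and `b` stand for an earlier and a later partial sum. As `v - a` and `b - a` share a
leading term, `v - b` is infinitely smaller than `ω^x`, whereas a multiple of `|v - b|` exceeds
`ω^y`. -/
theorem exponent_lt_of_isLeading {r t : ℝ} {a b v : Surreal.{u}} {x y : PGame.{u}}
    (hx : x.IsSurreal) (hy : y.IsSurreal) (ht : t ≠ 0)
    (h₁ : IsLeading r (val (omegaPow x)) (v - a)) (h₂ : IsLeading r (val (omegaPow x)) (b - a))
    (h₃ : IsLeading t (val (omegaPow y)) (v - b)) : y < x := by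
  refine hy.lt_of_not_le hx fun hle => ?_
  obtain ⟨n, hn⟩ := h₃.exists_le ht (val_omegaPow_pos hy)
  have hn0 : n ≠ 0 := by
    rintro rfl
    rw [Nat.cast_zero, zero_mul] at hn
    exact hn.not_gt (val_omegaPow_pos hy)
  have hn' : (0 : Surreal.{u}) < n := by positivity
  have h₄ := h₁ (2 * n) (by positivity)
  have h₅ := h₂ (2 * n) (by positivity)
  have h₆ := val_omegaPow_le hx hy hle
  have h₇ := abs_sub (v - a - val (ofReal.{u} r) * val (omegaPow x))
    (b - a - val (ofReal.{u} r) * val (omegaPow x))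
  rw [sub_sub_sub_cancel_right, sub_sub_sub_cancel_right] at h₇
  have h₈ := mul_le_mul_of_nonneg_left h₇ hn'.le
  push_cast at h₄ h₅
  linarith

/-! ### The normal form -/

/-- The partial sum `s_β`, the exponent `y_β` and the coefficient `r_β` of the normal form of `x`,
meaningful as long as `s_γ` is not equivalent to `x` for `γ < β`. -/
def normalForm (x : PGame.{u}) (β : Ordinal.{u}) : PGame.{u} × PGame.{u} × ℝ :=
  let prev : Ordinal.{u} → PGame.{u} × PGame.{u} × ℝ := fun γ =>
    -- The default is never consulted, since the class `I_β` depends only on indices below `β`.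
    open Classical in if _ : γ < β then normalForm x γ else default
  let s := Classical.epsilon (IsSimplest
    {a | InTerms β (fun γ => (prev γ).1) (fun γ => (prev γ).2.1) (fun γ => (prev γ).2.2) a})
  (s, Classical.epsilon fun p : PGame.{u} × ℝ =>
    p.1.IsUSurreal ∧ p.2 ≠ 0 ∧ IsLeading p.2 (val (omegaPow p.1)) (val x - val s))
termination_by β

/-- The partial sums of the normal form of `x`. -/
def nfSum (x : PGame.{u}) (β : Ordinal.{u}) : PGame.{u} := (normalForm x β).1

/-- The exponents of the normal form of `x`. -/
def nfExp (x : PGame.{u}) (β : Ordinal.{u}) : PGame.{u} := (normalForm x β).2.1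

/-- The coefficients of the normal form of `x`. -/
def nfCoeff (x : PGame.{u}) (β : Ordinal.{u}) : ℝ := (normalForm x β).2.2

theorem nfSum_eq (x : PGame.{u}) (β : Ordinal.{u}) : nfSum x β =
    Classical.epsilon (IsSimplest {a | InTerms β (nfSum x) (nfExp x) (nfCoeff x) a}) := by
  rw [nfSum, normalForm]
  exact congrArg (fun I => Classical.epsilon (IsSimplest I)) (Set.ext fun a =>
    inTerms_congr (fun γ hγ => by simp [hγ, nfSum, nfExp, nfCoeff]) a)

theorem nfExp_nfCoeff_spec {x : PGame.{u}} {β : Ordinal.{u}} (h : val (nfSum x β) ≠ val x) :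
    (nfExp x β).IsUSurreal ∧ nfCoeff x β ≠ 0 ∧
      IsLeading (nfCoeff x β) (val (omegaPow (nfExp x β))) (val x - val (nfSum x β)) := by
  have hp : (normalForm x β).2 = Classical.epsilon fun p : PGame.{u} × ℝ =>
      p.1.IsUSurreal ∧ p.2 ≠ 0 ∧
        IsLeading p.2 (val (omegaPow p.1)) (val x - val (nfSum x β)) := by
    rw [nfSum, normalForm]
  obtain ⟨y, r, hyr⟩ := exists_leading_term (sub_ne_zero.2 h.symm)
  rw [nfExp, nfCoeff, hp]
  exact Classical.epsilon_spec (p := fun p : PGame.{u} × ℝ =>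
    p.1.IsUSurreal ∧ p.2 ≠ 0 ∧
        IsLeading p.2 (val (omegaPow p.1)) (val x - val (nfSum x β))) ⟨(y, r), hyr⟩

/-- By the choice of the terms, `x` itself lies in `I_β`; this keeps the class nonempty, at limit
indices as well as at successors. -/
theorem nfSum_spec {x : PGame.{u}} (hx : x.IsSurreal) (β : Ordinal.{u})
    (h : ∀ γ < β, val (nfSum x γ) ≠ val x) :
    InTerms β (nfSum x) (nfExp x) (nfCoeff x) x ∧
      IsSimplest {a | InTerms β (nfSum x) (nfExp x) (nfCoeff x) a} (nfSum x β) := by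
  induction β using WellFoundedLT.induction with
  | ind β ih =>
    have hs := fun γ (hγ : γ < β) => (ih γ hγ fun δ hδ => h δ (hδ.trans hγ)).2.1.isSurreal
    have hy := fun γ (hγ : γ < β) => (nfExp_nfCoeff_spec (h γ hγ)).1.isSurreal
    have hxt : InTerms β (nfSum x) (nfExp x) (nfCoeff x) x :=
      ⟨hx, fun γ hγ => (isTerm_iff (hs γ hγ) (hy γ hγ) hx).2 (nfExp_nfCoeff_spec (h γ hγ)).2.2⟩
    refine ⟨hxt, ?_⟩
    rw [nfSum_eq x β]
    exact Classical.epsilon_spec (exists_isSimplest_inTerms hs hy hxt)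

theorem nfSum_birthday_le {x : PGame.{u}} (hx : x.IsSurreal) (β : Ordinal.{u})
    (h : ∀ γ < β, val (nfSum x γ) ≠ val x) : (nfSum x β).birthday ≤ x.birthday := by
  obtain ⟨h₁, h₂⟩ := nfSum_spec hx β h
  obtain ⟨z, hz, hzx⟩ := exists_isUSurreal hx
  refine (h₂.birthday_le hz ⟨hz.isSurreal, fun γ hγ => ?_⟩).trans (hz.birthday_le hx hzx)
  have hs := (nfSum_spec hx γ fun δ hδ => h δ (hδ.trans hγ)).2.1.isSurreal
  have hy := (nfExp_nfCoeff_spec (h γ hγ)).1.isSurreal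
  rw [isTerm_iff hs hy hz.isSurreal, (val_eq_val hz.isSurreal hx).2 hzx,
    ← isTerm_iff hs hy hx]
  exact h₁.2 γ hγ

/-- The later sum `s_β` also lies in the larger class `I_γ`, whose simplest element is `s_γ`. The
two differ because `s_β - s_γ` has a leading term with nonzero coefficient. -/
theorem nfSum_birthday_lt {x : PGame.{u}} (hx : x.IsSurreal) {γ β : Ordinal.{u}} (hγβ : γ < β)
    (h : ∀ γ < β, val (nfSum x γ) ≠ val x) : (nfSum x γ).birthday < (nfSum x β).birthday := by
  obtain ⟨-, h₁⟩ := nfSum_spec hx γ fun δ hδ => h δ (hδ.trans hγβ)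
  obtain ⟨-, h₂⟩ := nfSum_spec hx β h
  refine h₁.2.2 _ h₂.1 (fun e => ?_) (h₂.2.1.mono hγβ.le)
  obtain ⟨h₃, h₄, -⟩ := nfExp_nfCoeff_spec (h γ hγβ)
  have := (isTerm_iff h₁.1.isSurreal h₃.isSurreal h₂.1.isSurreal).1 (h₂.2.1.2 γ hγβ)
  rw [e, sub_self] at this
  exact not_isLeading_zero h₄ (val_omegaPow_pos h₃.isSurreal) this

/-- Were `x` never reached, strict growth would give `β ≤ 𝔟(s_β)` for all `β`, contradicting `𝔟(s_β)
≤ 𝔟(x)` at the successor of `𝔟(x)`. -/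
theorem exists_nfSum_eq {x : PGame.{u}} (hx : x.IsSurreal) :
    ∃ θ : Ordinal.{u}, val (nfSum x θ) = val x ∧ ∀ γ < θ, val (nfSum x γ) ≠ val x := by
  have hex : ∃ θ : Ordinal.{u}, val (nfSum x θ) = val x := by
    by_contra hcon
    push Not at hcon
    have hmono : StrictMono fun β => (nfSum x β).birthday := fun γ β hγβ =>
      nfSum_birthday_lt hx hγβ fun δ _ => hcon δ
    have h₁ := hmono.le_apply (x := Order.succ x.birthday)
    have h₂ := nfSum_birthday_le hx (Order.succ x.birthday) fun δ _ => hcon δ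
    exact (Order.lt_succ x.birthday).not_ge (h₁.trans h₂)
  obtain ⟨θ, hθ, hmin⟩ := Ordinal.lt_wf.has_min {θ | val (nfSum x θ) = val x} hex
  exact ⟨θ, hθ, fun γ hγ e => hmin γ e hγ⟩

end

end PGame

/-! ### Existence and uniqueness of the normal form -/

theorem mainTheorem1 (x : PGame.{u}) (hx : x.IsSurreal) :
    ∃ (θ : Ordinal.{u}) (y : Ordinal.{u} → PGame.{u}) (r : Ordinal.{u} → ℝ),
      PGame.IsSeries θ y r ∧
      (∃! z : PGame.{u}, PGame.IsSum θ y r z) ∧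
      (∀ z : PGame.{u}, PGame.IsSum θ y r z → x ≈ z ∧ z.birthday ≤ x.birthday) ∧
      (∀ (θ' : Ordinal.{u}) (y' : Ordinal.{u} → PGame.{u}) (r' : Ordinal.{u} → ℝ) (z' : PGame.{u}),
        PGame.IsSeries θ' y' r' → PGame.IsSum θ' y' r' z' → x ≈ z' →
          θ' = θ ∧ ∀ β < θ, y' β = y β ∧ r' β = r β) := by
  open PGame in
  obtain ⟨θ, hθ, hmin⟩ := exists_nfSum_eq hx
  have hspec := fun β (hβ : β ≤ θ) =>
    nfSum_spec hx β fun γ hγ => hmin γ (hγ.trans_le hβ)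
  have hterm := fun β (hβ : β < θ) => nfExp_nfCoeff_spec (hmin β hβ)
  have hsU := fun β (hβ : β ≤ θ) => (hspec β hβ).2.1
  have hsimp := fun β (hβ : β ≤ θ) => simplestOn_of_isSimplest (hspec β hβ).2
  have hsum : IsSum θ (nfExp x) (nfCoeff x) (nfSum x θ) := ⟨_, hsU, hsimp, rfl⟩
  refine ⟨θ, nfExp x, nfCoeff x, ⟨fun β hβ => (hterm β hβ).2.1, fun β hβ => (hterm β hβ).1,
    fun γ β hγβ hβ => ?_⟩, ⟨_, hsum, fun z hz => isSum_unique hz hsum⟩, fun z hz => ?_,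
    fun θ' y' r' z' hser' hsum' hxz => ?_⟩
  · have hγ := hγβ.trans hβ
    refine exponent_lt_of_isLeading (hterm γ hγ).1.isSurreal (hterm β hβ).1.isSurreal
      (hterm β hβ).2.1 (hterm γ hγ).2.2 ?_ (hterm β hβ).2.2
    exact (isTerm_iff (hsU γ hγ.le).isSurreal (hterm γ hγ).1.isSurreal (hsU β hβ.le).isSurreal).1
      ((hspec β hβ.le).2.2.1.2 γ hγβ)
  · obtain rfl := isSum_unique hz hsum
    exact ⟨(val_eq_val hx (hsU θ le_rfl).isSurreal).1 hθ.symm, nfSum_birthday_le hx θ hmin⟩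
  · obtain ⟨s', hsU', hsimp', rfl⟩ := hsum'
    have hval : val (s' θ') = val x :=
      (val_eq_val (hsU' θ' le_rfl).isSurreal hx).2 (equiv_symm hxz)
    -- The last entry `s' θ'` belongs to its own class and has the value of `x`, so the terms of the
    -- competing series are leading terms of remainders of `x`.
    have hterm' : ∀ β < θ', IsLeading (r' β) (val (omegaPow (y' β))) (val x - val (s' β)) := by
      intro β hβ
      rw [← hval]
      exact (isTerm_iff (hsU' β hβ.le).isSurreal (hser'.2.1 β hβ).isSurreal
        (hsU' θ' le_rfl).isSurreal).1
        (((simplestOn_iff (pos_of_gt hβ)).1 (hsimp' θ' le_rfl)).2.1.2 β hβ)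
    have hexp : ∀ β, β < θ → β < θ' → nfSum x β = s' β →
        nfExp x β = y' β ∧ nfCoeff x β = r' β := by
      intro β hβ hβ' e
      have h₁ := hterm' β hβ'
      rw [← e] at h₁
      obtain ⟨hU, h0, h₂⟩ := hterm β hβ
      have hU' := hser'.2.1 β hβ'
      have ey := hU.eq_of_equiv hU'
        ⟨h₁.exponent_le hU'.isSurreal hU.isSurreal h0 h₂,
          h₂.exponent_le hU.isSurreal hU'.isSurreal (hser'.1 β hβ') h₁⟩
      rw [← ey] at h₁
      exact ⟨ey, h₂.unique_coeff h₁⟩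
    have hagree : ∀ β, β ≤ θ → β ≤ θ' → nfSum x β = s' β := by
      intro β
      induction β using WellFoundedLT.induction with
      | ind β ih =>
        intro hβ hβ'
        refine simplestOn_unique (fun γ hγ => ?_) (hsU β hβ) (hsU' β hβ') (hsimp β hβ)
          (hsimp' β hβ')
        have e := ih γ hγ (hγ.le.trans hβ) (hγ.le.trans hβ')
        exact ⟨e, hexp γ (hγ.trans_le hβ) (hγ.trans_le hβ') e⟩
    -- A shorter competitor would reach `x` before the first index `θ` that does. A longer one would
    -- have a nonzero term at `θ`, where the remainder is already zero.
    obtain rfl : θ' = θ := by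
      obtain h | h | h := lt_trichotomy θ' θ
      · have := hagree θ' h.le le_rfl
        exact (hmin θ' h (this ▸ hval)).elim
      · exact h
      · have e := hagree θ le_rfl h.le
        have h₁ := hterm' θ h
        rw [← e, hθ, sub_self] at h₁
        exact (not_isLeading_zero (hser'.1 θ h)
          (val_omegaPow_pos (hser'.2.1 θ h).isSurreal) h₁).elim
    refine ⟨rfl, fun β hβ => ?_⟩
    have := hexp β hβ hβ (hagree β hβ.le hβ.le)
    exact ⟨this.1.symm, this.2.symm⟩
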